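/- **Setting.** Let $\mathcal B$ be an infinite set of (uniquely identified) blocks and $b_0\in\mathcal B$ a genesis block. A *blockchain* is a finite sequence of pairwise distinct blocks starting with $b_0$; $bc[i]$ is its block at position $i$, with $bc[i]=\bot$ past the end. Let $P$ be any predicate on blockchains (validity) and $\mathrm{length}$ any function from blockchains to $\mathbb N$ with $\mathrm{length}(bc^\frown b)>\mathrm{length}(bc)$ whenever $bc$ and $bc^\frown b$ are blockchains (for example the number of blocks). Processes invoke, one operation at a time, $\mathrm{append}(b)$ (which returns $\top$ or $\bot$) and $\mathrm{read}()$ (which returns a blockchain). A *history* is a set of timed invocation and response events. Write $e\nearrow e'$ for the order on its events generated by: $e$ precedes $e'$ at the same process; or $e$ is a response and $e'$ a later invocation. Write $r/bc$ for a response event of a $\mathrm{read}$ that returns $bc$. A history satisfies *unknown bounded displacement eventual prefix* (for $P$, $\mathrm{length}$) if * (chain validity) $P(bc)$ holds for every $r/bc$; * (chain integrity) for every $r/bc$ and every block $b\ne b_0$ of $bc$, $\mathrm{append}(b)$ has been invoked before $r$; * (eventual prefix) if there are infinitely many $\mathrm{read}$ invocations and responses, then for every $r/bc$ and every $i$ with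 $bc[i]\ne\bot$ there is $r'/bc'$ such that $bc'[i]=bc''[i]$ for all $r''/bc''$ with $r'\nearrow r''$; * (ever growing tree) if there are infinitely many invocations and responses of $\mathrm{append}$ and of $\mathrm{read}$, then for every $k\in\mathbb N$ there is $r/bc$ with $\mathrm{length}(bc)>k$; * (bounded displacement) there is $dis\in\mathbb N$, which may depend on the history, such that for all $r/bc$, $r'/bc'$ with $r\nearrow r'$ and all $i\in\mathbb N$ with $i\le \mathrm{length}(bc)-dis$ one has $bc[i]=bc'[i]$. Consider a finite or countably infinite set of at least two processes, and let $f\ge 1$. In every execution a set $F$ of at most $f$ processes is Byzantine; the others are correct and run a deterministic protocol. The processes communicate in one of two ways. * *Asynchronous message passing*: channels are reliable with unbounded delays and receivers know the senders; every message sent to a correct process is eventually received; a Byzantine process may send arbitrary messages in its own name. * *Asynchronous shared memory*: atomic read/write registers, each with a given set of processes that may write it; a Byzantine process may write arbitrary values to the registers it may write. In both, each correct process takes infinitely many steps, without any bound on relative speeds. Operations are invoked at correct processes at arbitrary times when no operation is pending there, and correct processes never append $b_0$ or the same block twice. A history of an execution consists of the events of the correct processes together with any invocations of $\mathrm{append}$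 by Byzantine processes. A protocol *solves unknown bounded displacement eventual prefix with at most $f$ Byzantine processes* if, in every execution with at most $f$ Byzantine processes, every operation invoked by a correct process returns, and some history of the execution satisfies unknown bounded displacement eventual prefix. **Theorem.** For every $f\ge 1$, no protocol solves unknown bounded displacement eventual prefix with at most $f$ Byzantine processes, neither in an asynchronous message-passing system nor in an asynchronous shared-memory system. -/

import Mathlib

universe uP uB u v w

set_option linter.checkUnivs false

/-! ### Blockchains, operations and concurrent histories -/

/-- A blockchain over the set `B` of uniquely identified blocks with genesis block `g`: a path of
a block tree read from its root, i.e. a sequence of pairwise distinct blocks starting with `g`. -/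
structure Blockchain (B : Type uB) (g : B) where
  blocks : List B
  head_eq : blocks.head? = some g
  nodup : blocks.Nodup

/-- The inputs of the block tree object. -/
inductive Call (B : Type uB) where
  | append (b : B)
  | read

/-- The outputs of the block tree object: `⊤` / `⊥` for `append`, a blockchain for `read`. -/
inductive Reply (B : Type uB) (g : B) where
  | append (ok : Bool)
  | read (bc : Blockchain B g)

/-- The reply is of the kind that the call expects. -/
def Reply.Answers {B : Type uB} {g : B} : Reply B g → Call B → Prop
  | .append _, .append _ => True
  | .read _, .read => True
  | _, _ => False

/-- Events are invocations and responses. -/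
inductive Label (B : Type uB) (g : B) where
  | inv (c : Call B)
  | rsp (r : Reply B g)

/-- A labelled event, with the process that produces it and the time at which it occurs. -/
structure Event (Proc : Type uP) (B : Type uB) (g : B) where
  time : ℕ
  proc : Proc
  label : Label B g

/-- A concurrent history, given by its set of events; the three orders are defined below. -/
abbrev History (Proc : Type uP) (B : Type uB) (g : B) := Set (Event Proc B g)

namespace History

variable {Proc : Type uP} {B : Type uB} {g : B}

/-- Process order. -/
def ProcOrder (e e' : Event Proc B g) : Prop :=
  e.proc = e'.proc ∧ e.time < e'.time

/-- Operation order: `e` is the response of an operation, `e'` is a later invocation. -/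
def OpOrder (e e' : Event Proc B g) : Prop :=
  (∃ r, e.label = .rsp r) ∧ (∃ c, e'.label = .inv c) ∧ e.time < e'.time

/-- Program order on the events of `H`: the order generated by process and operation order. -/
def ProgOrder (H : History Proc B g) : Event Proc B g → Event Proc B g → Prop :=
  Relation.TransGen fun e e' => e ∈ H ∧ e' ∈ H ∧ (ProcOrder e e' ∨ OpOrder e e')

/-- `r` is the response event of a `read` of the history `H` that returns the chain `bc`. -/
def IsRead (H : History Proc B g) (r : Event Proc B g) (bc : Blockchain B g) : Prop :=
  r ∈ H ∧ r.label = .rsp (.read bc)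

/-- `a` is the invocation of `append(b)` in `H`. -/
def IsAppendInv (H : History Proc B g) (a : Event Proc B g) (b : B) : Prop :=
  a ∈ H ∧ a.label = .inv (.append b)

/-- Infinitely many invocations and responses of `read`. -/
def InfinitelyManyReads (H : History Proc B g) : Prop :=
  {e | e ∈ H ∧ e.label = .inv .read}.Infinite ∧ {e | ∃ bc, H.IsRead e bc}.Infinite

/-- Infinitely many invocations and responses of `append`. -/
def InfinitelyManyAppends (H : History Proc B g) : Prop :=
  {e | ∃ b, H.IsAppendInv e b}.Infinite ∧
    {e | e ∈ H ∧ ∃ ok, e.label = .rsp (.append ok)}.Infinite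

/-- Each returned chain is valid. -/
def ChainValidity (P : Blockchain B g → Prop) (H : History Proc B g) : Prop :=
  ∀ r bc, H.IsRead r bc → P bc

/-- A returned block other than the genesis block was the parameter of an earlier invocation of
`append` (which may be concurrent with the `read`). -/
def ChainIntegrity (H : History Proc B g) : Prop :=
  ∀ r bc, H.IsRead r bc → ∀ b ∈ bc.blocks, b ≠ g →
    ∃ a, H.IsAppendInv a b ∧ a.time < r.time

/-- Each position that occurs in a returned chain eventually stabilizes. The value of `bc[i]` is
`none` past the end of the chain. -/
def EventualPrefix (H : History Proc B g) : Prop :=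
  H.InfinitelyManyReads →
    ∀ r bc, H.IsRead r bc → ∀ i : ℕ, bc.blocks[i]? ≠ none →
      ∃ r' bc', H.IsRead r' bc' ∧
        ∀ r'' bc'', H.IsRead r'' bc'' → H.ProgOrder r' r'' → bc'.blocks[i]? = bc''.blocks[i]?

/-- With infinitely many `append`s and `read`s, the returned chains are of unbounded length. -/
def EverGrowingTree (len : Blockchain B g → ℕ) (H : History Proc B g) : Prop :=
  H.InfinitelyManyAppends → H.InfinitelyManyReads →
    ∀ k : ℕ, ∃ r bc, H.IsRead r bc ∧ k < len bc

/-- The eventual prefix consistency criterion. -/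
def EventualPrefixConsistent (P : Blockchain B g → Prop) (len : Blockchain B g → ℕ)
    (H : History Proc B g) : Prop :=
  H.ChainValidity P ∧ H.ChainIntegrity ∧ H.EventualPrefix ∧ H.EverGrowingTree len

/-- Bounded displacement; the bound may be different for different histories. -/
def BoundedDisplacement (len : Blockchain B g → ℕ) (H : History Proc B g) : Prop :=
  ∃ dis : ℕ, ∀ r bc r' bc', H.IsRead r bc → H.IsRead r' bc' → H.ProgOrder r r' →
    ∀ i : ℕ, i + dis ≤ len bc → bc.blocks[i]? = bc'.blocks[i]?

/-- Unknown bounded displacement eventual prefix consistency. -/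
def UBDEP (P : Blockchain B g → Prop) (len : Blockchain B g → ℕ) (H : History Proc B g) : Prop :=
  H.EventualPrefixConsistent P len ∧ H.BoundedDisplacement len

end History

/-! ### Asynchronous systems with Byzantine processes -/

/-- A deterministic protocol together with the medium (network or shared memory) on which it
runs. Message-passing and shared-memory protocols are turned into such systems below.
* `enabled p a m`: in the medium `m` the process `p` can take a step of kind `a` (in a network:
  receive a given message in transit, or no message);
* `step p a l m`: the step of kind `a` that a correct process `p` takes in the local state `l`:
  new local state, new medium, and possibly a reply to the current operation;
* `byz p m m'`: a Byzantine process `p` can change the medium `m` to `m'` in one step. -/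
structure AsyncSystem (Proc : Type uP) (B : Type uB) (g : B) where
  Loc : Type u
  Med : Type v
  Kind : Type w
  init : Proc → Loc
  med₀ : Med
  invoke : Proc → Loc → Call B → Loc
  enabled : Proc → Kind → Med → Prop
  step : Proc → Kind → Loc → Med → Loc × Med × Option (Reply B g)
  byz : Proc → Med → Med → Prop

namespace AsyncSystem

variable {Proc : Type uP} {B : Type uB} {g : B}

/-- Local states, current operation of each process (if any), and medium. -/
structure Config (S : AsyncSystem.{uP, uB, u, v, w} Proc B g) where
  loc : Proc → S.Loc
  pend : Proc → Option (Call B)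
  med : S.Med

/-- What happens at one instant: an operation is invoked at a correct process, a correct process
takes a step of its protocol, or a Byzantine process acts. -/
inductive Action (S : AsyncSystem.{uP, uB, u, v, w} Proc B g) where
  | call (p : Proc) (c : Call B)
  | step (p : Proc) (a : S.Kind)
  | byz (p : Proc)

variable (S : AsyncSystem.{uP, uB, u, v, w} Proc B g)

def initConfig : S.Config where
  loc := S.init
  pend := fun _ => none
  med := S.med₀

/-- In the configuration `C`, the process `p` returns `r` by a step of kind `a`: the protocol
outputs `r` and `r` answers the current operation. Other outputs are discarded. -/
def Responds (C : S.Config) (p : Proc) (a : S.Kind) (r : Reply B g) : Prop :=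
  (S.step p a (C.loc p) C.med).2.2 = some r ∧ ∃ c, C.pend p = some c ∧ r.Answers c

/-- The transitions when `F` is the set of Byzantine processes. -/
def Transition (F : Finset Proc) (C : S.Config) : S.Action → S.Config → Prop
  | .call p c, C' =>
      p ∉ F ∧ C.pend p = none ∧
      C'.loc p = S.invoke p (C.loc p) c ∧ C'.pend p = some c ∧
      (∀ q, q ≠ p → C'.loc q = C.loc q ∧ C'.pend q = C.pend q) ∧ C'.med = C.med
  | .step p a, C' =>
      p ∉ F ∧ S.enabled p a C.med ∧
      C'.loc p = (S.step p a (C.loc p) C.med).1 ∧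
      C'.med = (S.step p a (C.loc p) C.med).2.1 ∧
      ((∃ r, S.Responds C p a r) → C'.pend p = none) ∧
      ((¬ ∃ r, S.Responds C p a r) → C'.pend p = C.pend p) ∧
      ∀ q, q ≠ p → C'.loc q = C.loc q ∧ C'.pend q = C.pend q
  | .byz p, C' =>
      p ∈ F ∧ S.byz p C.med C'.med ∧ C'.loc = C.loc ∧ C'.pend = C.pend

/-- An infinite asynchronous execution with set `F` of Byzantine processes. There is no bound on
relative speeds or on delays: a step that a correct process can take is only required to be taken
at some later time. Blocks are uniquely identified, so no block is appended twice by correct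
processes. -/
structure Execution (F : Finset Proc) where
  conf : ℕ → S.Config
  act : ℕ → S.Action
  conf_zero : conf 0 = S.initConfig
  trans : ∀ t, S.Transition F (conf t) (act t) (conf (t + 1))
  fair : ∀ p, p ∉ F → ∀ a t, S.enabled p a (conf t).med → ∃ t', t ≤ t' ∧ act t' = .step p a
  append_ne : ∀ t p b, act t = .call p (.append b) → b ≠ g
  append_unique : ∀ t t' p p' b, act t = .call p (.append b) → act t' = .call p' (.append b) →
    t = t'

variable {S} {F : Finset Proc}

namespace Execution

/-- The event `e` is produced by a correct process in the execution. -/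
def Produces (X : S.Execution F) (e : Event Proc B g) : Prop :=
  match e.label with
  | .inv c => X.act e.time = .call e.proc c
  | .rsp r => ∃ a, X.act e.time = .step e.proc a ∧ S.Responds (X.conf e.time) e.proc a r

/-- Every operation invoked at a correct process returns. -/
def Terminates (X : S.Execution F) : Prop :=
  ∀ p, p ∉ F → ∀ t, (X.conf t).pend p ≠ none → ∃ t', t ≤ t' ∧ (X.conf t').pend p = none

/-- `H` is a history of the execution. It consists of the events of the correct processes and of
invocations of `append` by Byzantine processes. The latter may be any: a Byzantine process does
not have to use the interface of the object in order to spread a block, so which blocks it counts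
as having appended is not determined by the execution. -/
def IsHistory (X : S.Execution F) (H : History Proc B g) : Prop :=
  (∀ e, e.proc ∉ F → (e ∈ H ↔ X.Produces e)) ∧
    ∀ e ∈ H, e.proc ∈ F → ∃ b, e.label = .inv (.append b)

end Execution

variable (S)

/-- The protocol solves unknown bounded displacement eventual prefix when at most `f` processes
are Byzantine. -/
def SolvesUBDEP (P : Blockchain B g → Prop) (len : Blockchain B g → ℕ) (f : ℕ) : Prop :=
  ∀ F : Finset Proc, F.card ≤ f → ∀ X : S.Execution F,
    X.Terminates ∧ ∃ H : History Proc B g, X.IsHistory H ∧ H.UBDEP P len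

end AsyncSystem

/-! ### Message passing -/

/-- A deterministic message-passing protocol. In a step a process receives at most one message,
whose sender it knows, sends finitely many messages to each process and possibly replies to its
current operation. -/
structure MessagePassingProtocol (Proc : Type uP) (B : Type uB) (g : B) where
  Loc : Type u
  Msg : Type u
  init : Proc → Loc
  invoke : Proc → Loc → Call B → Loc
  step : Proc → Loc → Option (Proc × Msg) → Loc × (Proc → Multiset Msg) × Option (Reply B g)

namespace MessagePassingProtocol

variable {Proc : Type uP} {B : Type uB} {g : B}

open Classical in
/-- `net q r` is the multiset of messages in transit from `q` to `r`. This is the network after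
`p` has received `x`. -/
noncomputable def receive {Msg : Type u} (p : Proc) (x : Option (Proc × Msg))
    (net : Proc → Proc → Multiset Msg) : Proc → Proc → Multiset Msg :=
  fun q r => match x with
    | none => net q r
    | some (s, m) => if q = s ∧ r = p then (net q r).erase m else net q r

open Classical in
/-- The network after `p` has sent the messages `out r` to each process `r`. -/
noncomputable def send {Msg : Type u} (p : Proc) (out : Proc → Multiset Msg)
    (net : Proc → Proc → Multiset Msg) : Proc → Proc → Multiset Msg :=
  fun q r => if q = p then net q r + out r else net q r

/-- The asynchronous reliable network: channels neither lose, duplicate nor create messages. A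
Byzantine process can send any messages in its own name and discard messages sent to it. -/
noncomputable def toSystem (π : MessagePassingProtocol.{uP, uB, u} Proc B g) :
    AsyncSystem Proc B g where
  Loc := π.Loc
  Med := Proc → Proc → Multiset π.Msg
  Kind := Option (Proc × π.Msg)
  init := π.init
  med₀ := fun _ _ => 0
  invoke := π.invoke
  enabled := fun p x net => ∀ q m, x = some (q, m) → m ∈ net q p
  step := fun p x l net =>
    ((π.step p l x).1, send p (π.step p l x).2.1 (receive p x net), (π.step p l x).2.2)
  byz := fun p net net' =>
    (∀ r, r ≠ p → net p r ≤ net' p r) ∧ (∀ q, q ≠ p → net' q p ≤ net q p) ∧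
      ∀ q r, q ≠ p → r ≠ p → net' q r = net q r

end MessagePassingProtocol

/-! ### Shared memory -/

/-- One atomic step of a process in shared memory: read a register, write a register, or do a
local computation. -/
inductive Access (Reg Val Loc Out : Type*) where
  | read (x : Reg) (next : Val → Loc × Option Out)
  | write (x : Reg) (y : Val) (next : Loc × Option Out)
  | skip (next : Loc × Option Out)

/-- A deterministic protocol over atomic read/write registers. The registers that a process may
write are given by `mayWrite`, so that single-writer and multi-writer registers are covered. -/
structure SharedMemoryProtocol (Proc : Type uP) (B : Type uB) (g : B) where
  Loc : Type u
  Reg : Type u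
  Val : Type u
  init : Proc → Loc
  mem₀ : Reg → Val
  mayWrite : Proc → Reg → Prop
  invoke : Proc → Loc → Call B → Loc
  program : Proc → Loc → Access Reg Val Loc (Reply B g)

namespace SharedMemoryProtocol

variable {Proc : Type uP} {B : Type uB} {g : B}

open Classical in
/-- The memory after `p` has written `y` to the register `x`, if `p` has the right to do so. -/
noncomputable def write (π : SharedMemoryProtocol.{uP, uB, u} Proc B g) (p : Proc) (x : π.Reg)
    (y : π.Val) (mem : π.Reg → π.Val) : π.Reg → π.Val :=
  fun z => if z = x ∧ π.mayWrite p x then y else mem z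

/-- The asynchronous shared memory. A Byzantine process can write any value to any register that
it has the right to write, or do nothing. -/
noncomputable def toSystem (π : SharedMemoryProtocol.{uP, uB, u} Proc B g) :
    AsyncSystem Proc B g where
  Loc := π.Loc
  Med := π.Reg → π.Val
  Kind := Unit
  init := π.init
  med₀ := π.mem₀
  invoke := π.invoke
  enabled := fun _ _ _ => True
  step := fun p _ l mem =>
    match π.program p l with
    | .read x next => ((next (mem x)).1, mem, (next (mem x)).2)
    | .write x y next => (next.1, π.write p x y mem, next.2)
    | .skip next => (next.1, mem, next.2)
  byz := fun p mem mem' => mem' = mem ∨ ∃ x y, mem' = π.write p x y mem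

end SharedMemoryProtocol

/-!
A protocol with unknown bounded displacement contains, from some moment on, a protocol for
consensus, and consensus cannot be reached when one process may stop (Fischer, Lynch, Paterson; for
shared memory, Loui and Abu-Amara).

Let each correct process alternate reads and appends of fresh blocks, each append choosing freely
between two blocks. If from each reachable state some continuation still shows a displacement of any
prescribed size, these continuations are concatenated to a fair execution without Byzantine
processes, whose displacement is unbounded. So there are a reachable state and a number `D` such
that all continuations of this state have displacement less than `D`
(`Machine.false_of_growth_of_stable`). From there on, a chain `bc` that is read fixes all positions
`i` with `i + D ≤ len bc`: two such chains agree at `i`, since both agree with a later read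
(`Machine.StableFrom.agree`). Thus each position is decided at most once, and by the ever growing
tree property it is decided in each fair execution with infinitely many operations, even if one
process stops. A process that stops, and the operations of which are no longer part of the history,
is a Byzantine process that has imitated a correct one before (`AsyncSystem.toExecution`,
`AsyncSystem.driven_grows`).

Some position is not determined in advance: otherwise the chains that are read would contain the
same new block whatever is appended, against chain integrity (`Machine.exists_bivalent`). A state
with an undetermined position leads, through any given possible move, to another one
(`Machine.exists_bivalent_extension`): if the move made such states univalent, two neighbouring
states with different values would be told apart by one process only, but the others have to decide
without it. A fair execution through states in which the position is undetermined never reads long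
chains, which contradicts the ever growing tree property.

The argument is carried out for machines with a medium in which single processes can be hidden
(`Machine.Hides`). In a network, a process that moves only adds messages to the channels of
the others; in shared memory, two moves of different processes commute, or one of them is noticed
by nobody else, or the second overwrites the first. In shared memory an idle process has to make
its call before it steps, so that it has only one kind of move at a time; the parameter `W` of
`AsyncSystem.driven` distinguishes the two cases.
-/

/-! ### Machines with moves of single processes -/

/-- An asynchronous machine: processes with local states in `L` share a medium in `M`. A move of
the process `p` has a kind in `K` and a free choice in `Bool`. `app p κ l m` says that `p` can make
a move of kind `κ`, `next` gives the new local state and the new medium, and `out` the output, which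
does not depend on the choice. -/
structure Machine (Proc : Type*) (L : Type*) (M : Type*) (K : Type*) (O : Type*) where
  app : Proc → K → L → M → Prop
  next : Proc → K → Bool → L → M → L × M
  out : Proc → K → L → M → Option O

namespace Machine

variable {Proc L M K O : Type*}

/-- The local states of all processes and the medium. -/
structure State (Proc L M : Type*) where
  loc : Proc → L
  med : M

/-- A move: who moves, the kind of the move and the free choice. -/
structure Move (Proc K : Type*) where
  proc : Proc
  kind : K
  choice : Bool

variable (𝓜 : Machine Proc L M K O)

/-- The move `e` is possible in the state `s`. -/
def Can (s : State Proc L M) (e : Move Proc K) : Prop :=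
  𝓜.app e.proc e.kind (s.loc e.proc) s.med

open Classical in
/-- The state after the move `e`. -/
noncomputable def apply (s : State Proc L M) (e : Move Proc K) : State Proc L M where
  loc := Function.update s.loc e.proc (𝓜.next e.proc e.kind e.choice (s.loc e.proc) s.med).1
  med := (𝓜.next e.proc e.kind e.choice (s.loc e.proc) s.med).2

/-- The output of the move `e`, with the process that makes it. -/
def output (s : State Proc L M) (e : Move Proc K) : Option (Proc × O) :=
  (𝓜.out e.proc e.kind (s.loc e.proc) s.med).map (Prod.mk e.proc)

/-- The state after a list of moves. -/
noncomputable def run (s : State Proc L M) (σ : List (Move Proc K)) : State Proc L M :=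
  σ.foldl 𝓜.apply s

/-- Each move of the list is possible when it is made. -/
def Valid : State Proc L M → List (Move Proc K) → Prop
  | _, [] => True
  | s, e :: σ => 𝓜.Can s e ∧ Valid (𝓜.apply s e) σ

/-- The outputs of a list of moves, in order. -/
noncomputable def outs : State Proc L M → List (Move Proc K) → List (Proc × O)
  | _, [] => []
  | s, e :: σ => (𝓜.output s e).toList ++ outs (𝓜.apply s e) σ

variable {𝓜}

@[simp] theorem run_nil (s : State Proc L M) : 𝓜.run s [] = s := rfl

@[simp] theorem run_cons (s : State Proc L M) (e : Move Proc K) (σ : List (Move Proc K)) :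
    𝓜.run s (e :: σ) = 𝓜.run (𝓜.apply s e) σ := rfl

@[simp] theorem run_append (s : State Proc L M) (σ τ : List (Move Proc K)) :
    𝓜.run s (σ ++ τ) = 𝓜.run (𝓜.run s σ) τ := by
  simp [run, List.foldl_append]

@[simp] theorem valid_nil (s : State Proc L M) : 𝓜.Valid s ([] : List (Move Proc K)) := trivial

@[simp] theorem valid_cons (s : State Proc L M) (e : Move Proc K) (σ : List (Move Proc K)) :
    𝓜.Valid s (e :: σ) ↔ 𝓜.Can s e ∧ 𝓜.Valid (𝓜.apply s e) σ := Iff.rfl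

@[simp] theorem valid_append (s : State Proc L M) (σ τ : List (Move Proc K)) :
    𝓜.Valid s (σ ++ τ) ↔ 𝓜.Valid s σ ∧ 𝓜.Valid (𝓜.run s σ) τ := by
  induction σ generalizing s with
  | nil => simp
  | cons e σ ih => simp [ih, and_assoc]

@[simp] theorem outs_nil (s : State Proc L M) : 𝓜.outs s ([] : List (Move Proc K)) = [] := rfl

@[simp] theorem outs_cons (s : State Proc L M) (e : Move Proc K) (σ : List (Move Proc K)) :
    𝓜.outs s (e :: σ) = (𝓜.output s e).toList ++ 𝓜.outs (𝓜.apply s e) σ := rfl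

@[simp] theorem outs_append (s : State Proc L M) (σ τ : List (Move Proc K)) :
    𝓜.outs s (σ ++ τ) = 𝓜.outs s σ ++ 𝓜.outs (𝓜.run s σ) τ := by
  induction σ generalizing s with
  | nil => simp
  | cons e σ ih => simp [ih]

theorem apply_loc_self (s : State Proc L M) (e : Move Proc K) :
    (𝓜.apply s e).loc e.proc = (𝓜.next e.proc e.kind e.choice (s.loc e.proc) s.med).1 := by
  simp [apply]

theorem apply_loc_of_ne (s : State Proc L M) (e : Move Proc K) {q : Proc} (h : q ≠ e.proc) :
    (𝓜.apply s e).loc q = s.loc q := by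
  simp [apply, h]

/-! ### Infinite runs -/

/-- The first `t` moves of an infinite sequence. -/
def initial (ev : ℕ → Move Proc K) (t : ℕ) : List (Move Proc K) := (List.range t).map ev

@[simp] theorem length_initial (ev : ℕ → Move Proc K) (t : ℕ) : (initial ev t).length = t := by
  simp [initial]

theorem initial_succ (ev : ℕ → Move Proc K) (t : ℕ) :
    initial ev (t + 1) = initial ev t ++ [ev t] := by
  simp [initial, List.range_succ]

theorem initial_prefix (ev : ℕ → Move Proc K) {t t' : ℕ} (h : t ≤ t') :
    initial ev t <+: initial ev t' := by
  induction t', h using Nat.le_induction with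
  | base => exact List.prefix_rfl
  | succ n _ ih =>
    rw [initial_succ]
    exact ih.trans (List.prefix_append _ _)

variable (𝓜)

/-- The state at time `t` of an infinite sequence of moves. -/
noncomputable def conf (s : State Proc L M) (ev : ℕ → Move Proc K) (t : ℕ) : State Proc L M :=
  𝓜.run s (initial ev t)

/-- Each move of the sequence is possible when it is made. -/
def IsRun (s : State Proc L M) (ev : ℕ → Move Proc K) : Prop :=
  ∀ t, 𝓜.Can (𝓜.conf s ev t) (ev t)

/-- Each kind of move that a process of `Q` can make is made at some later time. -/
def Fair (s : State Proc L M) (Q : Set Proc) (ev : ℕ → Move Proc K) : Prop :=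
  ∀ p ∈ Q, ∀ κ t, 𝓜.app p κ ((𝓜.conf s ev t).loc p) (𝓜.conf s ev t).med →
    ∃ t', t ≤ t' ∧ (ev t').proc = p ∧ (ev t').kind = κ

variable {𝓜}

@[simp] theorem conf_zero (s : State Proc L M) (ev : ℕ → Move Proc K) : 𝓜.conf s ev 0 = s := rfl

theorem conf_succ (s : State Proc L M) (ev : ℕ → Move Proc K) (t : ℕ) :
    𝓜.conf s ev (t + 1) = 𝓜.apply (𝓜.conf s ev t) (ev t) := by
  simp [conf, initial_succ]

theorem outs_initial_succ (s : State Proc L M) (ev : ℕ → Move Proc K) (t : ℕ) :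
    𝓜.outs s (initial ev (t + 1)) =
      𝓜.outs s (initial ev t) ++ (𝓜.output (𝓜.conf s ev t) (ev t)).toList := by
  simp [conf, initial_succ]

theorem IsRun.valid_initial {s : State Proc L M} {ev : ℕ → Move Proc K} (h : 𝓜.IsRun s ev)
    (t : ℕ) : 𝓜.Valid s (initial ev t) := by
  induction t with
  | zero => simp [initial]
  | succ t ih => simpa [initial_succ] using ⟨ih, h t⟩

theorem mem_outs_initial {s : State Proc L M} {ev : ℕ → Move Proc K} {t : ℕ} {x : Proc × O} :
    x ∈ 𝓜.outs s (initial ev t) ↔ ∃ t' < t, 𝓜.output (𝓜.conf s ev t') (ev t') = some x := by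
  induction t with
  | zero => simp [initial]
  | succ t ih =>
    rw [outs_initial_succ, List.mem_append, ih, Nat.exists_lt_succ_right]
    simp

/-- An ordered selection of the outputs of an initial part of a run that ends with `x`. -/
theorem sublist_outs_initial {s : State Proc L M} {ev : ℕ → Move Proc K} {t : ℕ} {x : Proc × O}
    {l : List (Proc × O)} (h : (l ++ [x]).Sublist (𝓜.outs s (initial ev t))) :
    ∃ t' < t, 𝓜.output (𝓜.conf s ev t') (ev t') = some x ∧
      l.Sublist (𝓜.outs s (initial ev t')) := by
  induction t with
  | zero => simp [initial] at h
  | succ t ih =>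
    rw [outs_initial_succ] at h
    cases ho : 𝓜.output (𝓜.conf s ev t) (ev t) with
    | none =>
      rw [ho] at h
      obtain ⟨t', h1, h2⟩ := ih (by simpa using h)
      exact ⟨t', h1.trans (Nat.lt_succ_self _), h2⟩
    | some y =>
      rw [ho, Option.toList_some] at h
      rw [← List.reverse_sublist] at h
      simp only [List.reverse_append, List.reverse_cons, List.reverse_nil, List.nil_append,
        List.cons_append] at h
      cases h with
      | cons _ h =>
        obtain ⟨t', h1, h2⟩ := ih (by rw [← List.reverse_sublist]; simpa using h)
        exact ⟨t', h1.trans (Nat.lt_succ_self _), h2⟩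
      | cons_cons _ h => exact ⟨t, Nat.lt_succ_self _, ho, List.reverse_sublist.1 h⟩

variable (𝓜)

/-- What makes it possible to run a machine fairly: moves stay possible until they are made, there
are countably many kinds of possible moves, and each process can always move. -/
structure Live : Prop where
  persists : ∀ (s : State Proc L M) (e e' : Move Proc K), 𝓜.Can s e → 𝓜.Can s e' →
    ¬ (e'.proc = e.proc ∧ e'.kind = e.kind) → 𝓜.Can (𝓜.apply s e') e
  countable : ∀ p l m, {κ | 𝓜.app p κ l m}.Countable
  exists_app : ∀ p l m, ∃ κ, 𝓜.app p κ l m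

variable {𝓜}

theorem Live.can_conf (h : 𝓜.Live) {s : State Proc L M} {ev : ℕ → Move Proc K}
    (hr : 𝓜.IsRun s ev) {e : Move Proc K} {t : ℕ} (he : 𝓜.Can (𝓜.conf s ev t) e)
    (hn : ∀ t', t ≤ t' → ¬ ((ev t').proc = e.proc ∧ (ev t').kind = e.kind)) {t' : ℕ}
    (ht : t ≤ t') : 𝓜.Can (𝓜.conf s ev t') e := by
  induction t', ht using Nat.le_induction with
  | base => exact he
  | succ n hn' ih =>
    rw [conf_succ]
    exact h.persists _ _ _ ih (hr n) (hn n hn')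

/-- A chain of finite prefixes, each of which is chosen after a request to make one given possible
move, can be driven to a run that is fair for the processes of `Q`. The `n`-th request is
decoded from `n`: a time `t`, a process, and an index in an enumeration of the kinds of moves that
this process can make at time `t`. -/
theorem Live.exists_fair_run [Countable Proc] (h : 𝓜.Live) (s : State Proc L M) {Q : Set Proc}
    (hQ : Q.Nonempty) (I : ℕ → List (Move Proc K) → Prop) (L₀ : List (Move Proc K)) (h₀ : I 0 L₀)
    (hI : ∀ n σ, I n σ → 𝓜.Valid s σ)
    (hstep : ∀ n σ, I n σ → ∀ p ∈ Q, ∀ κ, 𝓜.app p κ ((𝓜.run s σ).loc p) (𝓜.run s σ).med →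
      ∃ τ c, ⟨p, κ, c⟩ ∈ τ ∧ I (n + 1) (σ ++ τ)) :
    ∃ ev : ℕ → Move Proc K, 𝓜.IsRun s ev ∧ 𝓜.Fair s Q ev ∧ initial ev L₀.length = L₀ ∧
      ∀ n, ∃ t, n ≤ t ∧ L₀.length ≤ t ∧ I n (initial ev t) := by
  classical
  have : Nonempty Q := hQ.to_subtype
  obtain ⟨pr, hpr⟩ := exists_surjective_nat Q
  have hen : ∀ p l m, ∃ f : ℕ → K, {κ | 𝓜.app p κ l m} = Set.range f := fun p l m =>
    (h.countable p l m).exists_eq_range (h.exists_app p l m)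
  choose en hen using hen
  let rp : ℕ → Q := fun n => pr n.unpair.2.unpair.1
  let rk : ℕ → List (Move Proc K) → K := fun n σ =>
    en (rp n) ((𝓜.run s (σ.take n.unpair.1)).loc (rp n)) (𝓜.run s (σ.take n.unpair.1)).med
      n.unpair.2.unpair.2
  have hnext : ∀ n (σ : {σ // I n σ}), ∃ σ' : {σ // I (n + 1) σ}, ∃ τ, σ'.1 = σ.1 ++ τ ∧ τ ≠ [] ∧
      (𝓜.app (rp n) (rk n σ.1) ((𝓜.run s σ.1).loc (rp n)) (𝓜.run s σ.1).med →
        ∃ c, ⟨(rp n : Proc), rk n σ.1, c⟩ ∈ τ) := by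
    rintro n ⟨σ, hσ⟩
    by_cases ha : 𝓜.app (rp n) (rk n σ) ((𝓜.run s σ).loc (rp n)) (𝓜.run s σ).med
    · obtain ⟨τ, c, hc, hτ⟩ := hstep n σ hσ (rp n) (rp n).2 _ ha
      exact ⟨⟨_, hτ⟩, τ, rfl, List.ne_nil_of_mem hc, fun _ => ⟨c, hc⟩⟩
    · obtain ⟨κ, hκ⟩ := h.exists_app (rp n) ((𝓜.run s σ).loc (rp n)) (𝓜.run s σ).med
      obtain ⟨τ, c, hc, hτ⟩ := hstep n σ hσ (rp n) (rp n).2 _ hκ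
      exact ⟨⟨_, hτ⟩, τ, rfl, List.ne_nil_of_mem hc, fun h => absurd h ha⟩
  choose nx seg hnx hseg hserve using hnext
  let sq : (n : ℕ) → {σ // I n σ} := fun n => Nat.rec ⟨L₀, h₀⟩ (fun n σ => nx n σ) n
  have sq_succ : ∀ n, (sq (n + 1)).1 = (sq n).1 ++ seg n (sq n) := fun n => hnx n (sq n)
  have sq_mono : ∀ {m n}, m ≤ n → (sq m).1 <+: (sq n).1 := by
    intro m n hmn
    induction n, hmn using Nat.le_induction with
    | base => exact List.prefix_rfl
    | succ n _ ih => rw [sq_succ]; exact ih.trans (List.prefix_append _ _)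
  have sq_len : ∀ n, n ≤ (sq n).1.length := by
    intro n
    induction n with
    | zero => exact Nat.zero_le _
    | succ n ih =>
      have := List.length_pos_iff.2 (hseg n (sq n))
      rw [sq_succ, List.length_append]
      omega
  let ev : ℕ → Move Proc K := fun t => (sq (t + 1)).1[t]'(sq_len (t + 1))
  have hev : ∀ n t (ht : t < (sq n).1.length), (sq n).1[t] = ev t := by
    intro n t ht
    rcases le_total n (t + 1) with hle | hle
    · exact (sq_mono hle).getElem ht
    · exact ((sq_mono hle).getElem (sq_len (t + 1))).symm
  have hinit : ∀ n t, t ≤ (sq n).1.length → initial ev t = (sq n).1.take t := by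
    intro n t ht
    apply List.ext_getElem
    · simp [ht]
    · intro k h1 h2
      simp only [initial, List.getElem_map, List.getElem_range, List.getElem_take]
      exact (hev n k _).symm
  have hinit' : ∀ n, initial ev (sq n).1.length = (sq n).1 := fun n => by
    rw [hinit n _ le_rfl, List.take_length]
  have hrun : 𝓜.IsRun s ev := by
    intro t
    have h1 := hI _ _ (sq (t + 1)).2
    rw [← List.take_append_drop (t + 1) (sq (t + 1)).1, ← hinit (t + 1) (t + 1) (sq_len _),
      initial_succ] at h1
    simpa [conf] using ((valid_append _ _ _).1 ((valid_append _ _ _).1 h1).1).2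
  refine ⟨ev, hrun, ?_, hinit' 0, fun n => ⟨(sq n).1.length, sq_len n, ?_, ?_⟩⟩
  · intro p hp κ t hap
    by_contra! hcon
    obtain ⟨i, hi⟩ := hpr ⟨p, hp⟩
    have hk : κ ∈ Set.range (en p ((𝓜.conf s ev t).loc p) (𝓜.conf s ev t).med) := by
      rw [← hen]; exact hap
    obtain ⟨k, hk⟩ := hk
    set n := Nat.pair t (Nat.pair i k) with hn
    have htn : t ≤ n := Nat.left_le_pair _ _
    have hrp : rp n = ⟨p, hp⟩ := by simp [rp, hn, hi]
    have hrk : rk n (sq n).1 = κ := by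
      have : (sq n).1.take n.unpair.1 = initial ev t := by
        rw [hinit n t (htn.trans (sq_len n))]; simp [hn]
      simp only [rk, this, hrp]
      rw [← hk]
      simp [hn, conf]
    have hcan : 𝓜.Can (𝓜.conf s ev (sq n).1.length) ⟨p, κ, true⟩ :=
      h.can_conf hrun (e := ⟨p, κ, true⟩) hap (fun t' ht' hh => hcon t' ht' hh.1 hh.2)
        (htn.trans (sq_len n))
    have hs := hserve n (sq n)
    rw [hrk, hrp] at hs
    obtain ⟨c, hc⟩ := hs (by simpa [Can, conf, hinit'] using hcan)
    obtain ⟨j, hj, hje⟩ := List.getElem_of_mem hc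
    have hj' : (sq n).1.length + j < (sq (n + 1)).1.length := by
      rw [sq_succ, List.length_append]; omega
    have he : ev ((sq n).1.length + j) = ⟨p, κ, c⟩ := by
      rw [← hev (n + 1) _ hj', ← hje]
      simp only [sq_succ]
      rw [List.getElem_append_right (by omega)]
      simp
    exact hcon _ (htn.trans ((sq_len n).trans (Nat.le_add_right _ j))) (by rw [he]) (by rw [he])
  · exact (sq_mono (Nat.zero_le n)).length_le
  · rw [hinit']; exact (sq n).2

end Machine

namespace Machine

variable {Proc L M K O : Type*}

/-! ### Hiding a process -/

/-- The states `s` and `s'` are alike for everybody but `p`: the processes other than `p` have the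
same local states, and the media are related by `sim p`. -/
def Sim (sim : Proc → M → M → Prop) (p : Proc) (s s' : State Proc L M) : Prop :=
  (∀ q, q ≠ p → s.loc q = s'.loc q) ∧ sim p s.med s'.med

/-- The move `e'` has no influence on the move `e`, which leaves no trace of `e'` in the medium. -/
theorem sim_hidden {𝓜 : Machine Proc L M K O} {s : State Proc L M} {e e' : Move Proc K}
    (hne : e.proc ≠ e'.proc)
    (h : 𝓜.next e.proc e.kind e.choice (s.loc e.proc)
        (𝓜.next e'.proc e'.kind e'.choice (s.loc e'.proc) s.med).2 =
      𝓜.next e.proc e.kind e.choice (s.loc e.proc) s.med) :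
    Sim (fun _ m m' => m = m') e'.proc (𝓜.apply s e) (𝓜.apply (𝓜.apply s e') e) := by
  constructor
  · intro q hq
    by_cases hqe : q = e.proc
    · subst hqe
      rw [apply_loc_self, apply_loc_self, apply_loc_of_ne _ _ hne]
      exact congrArg Prod.fst h.symm
    · rw [apply_loc_of_ne _ _ hqe, apply_loc_of_ne _ _ hqe, apply_loc_of_ne _ _ hq]
  · classical
    simp only [apply, Function.update_of_ne hne]
    exact congrArg Prod.snd h.symm

/-- The move `e` has no influence on the process of `e'`, and the medium does not record the order
of the two moves. -/
theorem sim_comm {𝓜 : Machine Proc L M K O} {s : State Proc L M} {e e' : Move Proc K}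
    (hne : e.proc ≠ e'.proc)
    (h : (𝓜.next e'.proc e'.kind e'.choice (s.loc e'.proc)
        (𝓜.next e.proc e.kind e.choice (s.loc e.proc) s.med).2).1 =
      (𝓜.next e'.proc e'.kind e'.choice (s.loc e'.proc) s.med).1)
    (hm : (𝓜.next e.proc e.kind e.choice (s.loc e.proc)
        (𝓜.next e'.proc e'.kind e'.choice (s.loc e'.proc) s.med).2).2 =
      (𝓜.next e'.proc e'.kind e'.choice (s.loc e'.proc)
        (𝓜.next e.proc e.kind e.choice (s.loc e.proc) s.med).2).2) :
    Sim (fun _ m m' => m = m') e.proc (𝓜.apply (𝓜.apply s e') e) (𝓜.apply (𝓜.apply s e) e') := by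
  constructor
  · intro q hq
    rw [apply_loc_of_ne _ _ hq]
    by_cases hqe : q = e'.proc
    · subst hqe
      rw [apply_loc_self, apply_loc_self, apply_loc_of_ne _ _ hq]
      exact h.symm
    · rw [apply_loc_of_ne _ _ hqe, apply_loc_of_ne _ _ hqe, apply_loc_of_ne _ _ hq]
  · classical
    simp only [apply, Function.update_of_ne hne, Function.update_of_ne hne.symm]
    exact hm

/-- The relation `sim p m m'` on media says that all processes other than `p` can behave in `m'` as
in `m`. These are the conditions on it under which one silent process prevents agreement. The two
cases of `interplay` are those of message passing, where the moves of `p` restrict nobody else, and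
of shared memory, where a process has only one kind of move at a time and, of two moves of
different processes, the order is noticed by at most one of them, or the first is overwritten. -/
structure Hides (𝓜 : Machine Proc L M K O) (sim : Proc → M → M → Prop) : Prop where
  refl : ∀ p m, sim p m m
  next : ∀ p q κ c l m m', q ≠ p → sim p m m' → 𝓜.app q κ l m →
    𝓜.app q κ l m' ∧ (𝓜.next q κ c l m).1 = (𝓜.next q κ c l m').1 ∧
      𝓜.out q κ l m = 𝓜.out q κ l m' ∧ sim p (𝓜.next q κ c l m).2 (𝓜.next q κ c l m').2
  choice : ∀ p κ c c' l m, sim p (𝓜.next p κ c l m).2 (𝓜.next p κ c' l m).2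
  interplay :
    (∀ p κ c l m, 𝓜.app p κ l m → sim p m (𝓜.next p κ c l m).2) ∨
    (∀ p κ κ' l m, 𝓜.app p κ l m → 𝓜.app p κ' l m → κ = κ') ∧
      ∀ s e e', 𝓜.Can s e → 𝓜.Can s e' → e.proc ≠ e'.proc →
        Sim sim e'.proc (𝓜.apply s e) (𝓜.apply (𝓜.apply s e') e) ∨
        Sim sim e.proc (𝓜.apply (𝓜.apply s e') e) (𝓜.apply (𝓜.apply s e) e')

namespace Hides

variable {𝓜 : Machine Proc L M K O} {sim : Proc → M → M → Prop}

theorem sim_apply (h : 𝓜.Hides sim) {p : Proc} {s s' : State Proc L M} (hs : Sim sim p s s')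
    {e : Move Proc K} (he : e.proc ≠ p) (hc : 𝓜.Can s e) :
    𝓜.Can s' e ∧ 𝓜.output s e = 𝓜.output s' e ∧ Sim sim p (𝓜.apply s e) (𝓜.apply s' e) := by
  obtain ⟨h1, h2, h3, h4⟩ := h.next p e.proc e.kind e.choice _ _ _ he hs.2 hc
  have hl := hs.1 _ he
  refine ⟨by simpa [Can, ← hl] using h1, by simp [output, ← hl, h3], ?_, by
    simpa [apply, ← hl] using h4⟩
  intro q hq
  by_cases hqe : q = e.proc
  · subst hqe
    rw [apply_loc_self, apply_loc_self, ← hl, h2]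
  · rw [apply_loc_of_ne _ _ hqe, apply_loc_of_ne _ _ hqe, hs.1 q hq]

/-- What happens without `p` can also happen, with the same outputs, in a state that looks the same
to the other processes. -/
theorem sim_outs (h : 𝓜.Hides sim) {p : Proc} {s s' : State Proc L M} (hs : Sim sim p s s')
    {σ : List (Move Proc K)} (hσ : ∀ e ∈ σ, e.proc ≠ p) (hv : 𝓜.Valid s σ) :
    𝓜.Valid s' σ ∧ 𝓜.outs s' σ = 𝓜.outs s σ := by
  induction σ generalizing s s' with
  | nil => simp
  | cons e σ ih =>
    obtain ⟨h1, h2, h3⟩ := h.sim_apply hs (hσ e List.mem_cons_self) hv.1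
    obtain ⟨h4, h5⟩ := ih h3 (fun e he => hσ e (List.mem_cons_of_mem _ he)) hv.2
    exact ⟨⟨h1, h4⟩, by simp [h2, h5]⟩

theorem sim_choice (h : 𝓜.Hides sim) (s : State Proc L M) (p : Proc) (κ : K) (c c' : Bool) :
    Sim sim p (𝓜.apply s ⟨p, κ, c⟩) (𝓜.apply s ⟨p, κ, c'⟩) :=
  ⟨fun q hq => by rw [apply_loc_of_ne _ _ hq, apply_loc_of_ne _ _ hq], h.choice _ _ _ _ _ _⟩

end Hides

/-! ### Valency -/

section Valency

variable {B : Type*} {g : B} (𝓜 : Machine Proc L M K (Blockchain B g)) (len : Blockchain B g → ℕ)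

/-- Displacement less than `D` in a sequence of reads: if a process reads `z` and then `y`, both
after the read `x` was made, then `y` agrees with `x` up to the last `D` units of length. -/
def Stable (D : ℕ) (log : List (Proc × Blockchain B g)) : Prop :=
  ∀ x z y, [x, z, y].Sublist log → z.1 = y.1 →
    ∀ i, i + D ≤ len x.2 → x.2.blocks[i]? = y.2.blocks[i]?

/-- In some future of `s`, a chain that is long enough to fix position `i` has there the value
`v`. -/
def Val (D i : ℕ) (s : State Proc L M) (v : Option B) : Prop :=
  ∃ τ, 𝓜.Valid s τ ∧ ∃ o ∈ 𝓜.outs s τ, i + D ≤ len o.2 ∧ o.2.blocks[i]? = v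

/-- In some future of `s` in which `p` does not move, a chain that is long enough to fix position
`i` has there the value `v`. -/
def ValWithout (D i : ℕ) (p : Proc) (s : State Proc L M) (v : Option B) : Prop :=
  ∃ τ, 𝓜.Valid s τ ∧ (∀ e ∈ τ, e.proc ≠ p) ∧
    ∃ o ∈ 𝓜.outs s τ, i + D ≤ len o.2 ∧ o.2.blocks[i]? = v

/-- Two different values are still possible at position `i`. -/
def Bivalent (D i : ℕ) (s : State Proc L M) : Prop :=
  ∃ v w, 𝓜.Val len D i s v ∧ 𝓜.Val len D i s w ∧ v ≠ w

/-- Chains become long even if one process is silent and all choices are the same. -/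
def Grows (s₀ : State Proc L M) : Prop :=
  ∀ σ, 𝓜.Valid s₀ σ → ∀ p c k, ∃ τ, 𝓜.Valid (𝓜.run s₀ σ) τ ∧
    (∀ e ∈ τ, e.proc ≠ p ∧ e.choice = c) ∧ ∃ o ∈ 𝓜.outs (𝓜.run s₀ σ) τ, k < len o.2

/-- Some process will read twice more. -/
def Rereads (s₀ : State Proc L M) : Prop :=
  ∀ σ, 𝓜.Valid s₀ σ → ∃ τ, 𝓜.Valid (𝓜.run s₀ σ) τ ∧
    ∃ z y, [z, y].Sublist (𝓜.outs (𝓜.run s₀ σ) τ) ∧ z.1 = y.1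

/-- The displacement is less than `D` in all futures of `s`. -/
def StableFrom (D : ℕ) (s : State Proc L M) : Prop :=
  ∀ τ, 𝓜.Valid s τ → Stable len D (𝓜.outs s τ)

variable {𝓜 len} {D i : ℕ} {s₀ : State Proc L M}

theorem ValWithout.val {p : Proc} {s : State Proc L M} {v : Option B}
    (h : 𝓜.ValWithout len D i p s v) : 𝓜.Val len D i s v := by
  obtain ⟨τ, h1, -, h2⟩ := h
  exact ⟨τ, h1, h2⟩

theorem ValWithout.of_sim {sim : Proc → M → M → Prop} (hh : 𝓜.Hides sim) {p : Proc}
    {s s' : State Proc L M} {v : Option B} (h : 𝓜.ValWithout len D i p s v)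
    (hs : Sim sim p s s') : 𝓜.ValWithout len D i p s' v := by
  obtain ⟨τ, h1, h2, h3⟩ := h
  obtain ⟨h4, h5⟩ := hh.sim_outs hs h2 h1
  exact ⟨τ, h4, h2, h5 ▸ h3⟩

theorem Val.of_apply {s : State Proc L M} {e : Move Proc K} {v : Option B} (he : 𝓜.Can s e)
    (h : 𝓜.Val len D i (𝓜.apply s e) v) : 𝓜.Val len D i s v := by
  obtain ⟨τ, h1, o, h2, h3⟩ := h
  exact ⟨e :: τ, ⟨he, h1⟩, o, by simp [h2], h3⟩

theorem Grows.run (h : 𝓜.Grows len s₀) {σ : List (Move Proc K)} (hσ : 𝓜.Valid s₀ σ) :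
    𝓜.Grows len (𝓜.run s₀ σ) := by
  intro τ hτ
  simpa using h (σ ++ τ) (by simp [hσ, hτ])

theorem Rereads.run (h : 𝓜.Rereads s₀) {σ : List (Move Proc K)} (hσ : 𝓜.Valid s₀ σ) :
    𝓜.Rereads (𝓜.run s₀ σ) := by
  intro τ hτ
  simpa using h (σ ++ τ) (by simp [hσ, hτ])

theorem Grows.exists_valWithout (h : 𝓜.Grows len s₀) {σ : List (Move Proc K)}
    (hσ : 𝓜.Valid s₀ σ) (p : Proc) : ∃ v, 𝓜.ValWithout len D i p (𝓜.run s₀ σ) v := by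
  obtain ⟨τ, h1, h2, o, ho, hk⟩ := h σ hσ p true (i + D)
  exact ⟨_, τ, h1, fun e he => (h2 e he).1, o, ho, hk.le, rfl⟩

/-- All long enough chains agree: compare both with the second of two later reads of some
process. -/
theorem StableFrom.agree (hst : 𝓜.StableFrom len D s₀) (hre : 𝓜.Rereads s₀)
    {τ : List (Move Proc K)} (hτ : 𝓜.Valid s₀ τ) {o o' : Proc × Blockchain B g}
    (ho : o ∈ 𝓜.outs s₀ τ) (ho' : o' ∈ 𝓜.outs s₀ τ) (hl : i + D ≤ len o.2)
    (hl' : i + D ≤ len o'.2) : o.2.blocks[i]? = o'.2.blocks[i]? := by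
  obtain ⟨τ', h1, z, y, h2, h3⟩ := hre τ hτ
  have hs := hst (τ ++ τ') (by simp [hτ, h1])
  rw [outs_append] at hs
  have key : ∀ x ∈ 𝓜.outs s₀ τ, i + D ≤ len x.2 → x.2.blocks[i]? = y.2.blocks[i]? :=
    fun x hx hxl => hs x z y ((List.singleton_sublist.2 hx).append h2) h3 i hxl
  rw [key o ho hl, key o' ho' hl']

theorem StableFrom.val_eq (hst : 𝓜.StableFrom len D s₀) (hre : 𝓜.Rereads s₀)
    {σ : List (Move Proc K)} (hσ : 𝓜.Valid s₀ σ) {o : Proc × Blockchain B g}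
    (ho : o ∈ 𝓜.outs s₀ σ) (hl : i + D ≤ len o.2) {v : Option B}
    (hv : 𝓜.Val len D i (𝓜.run s₀ σ) v) : v = o.2.blocks[i]? := by
  obtain ⟨τ, h1, o', ho', hl', rfl⟩ := hv
  exact hst.agree hre (τ := σ ++ τ) (by simp [hσ, h1]) (by simp [ho']) (by simp [ho]) hl' hl

/-- The step of the bivalence argument: a state in which two values are possible at position `i` can
be led, through a given possible move, to another such state. Otherwise, all states that are
reached by making this move at some time are univalent. Two of them that come from neighbouring
states have the same value, because some process that stays silent afterwards hides the
difference; so they all have the same value, which then is the only one possible from the start. -/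
theorem exists_bivalent_extension (hl : 𝓜.Live) {sim : Proc → M → M → Prop} (hh : 𝓜.Hides sim)
    (hst : 𝓜.StableFrom len D s₀) (hre : 𝓜.Rereads s₀) (hgr : 𝓜.Grows len s₀)
    {ρ : List (Move Proc K)} (hρ : 𝓜.Valid s₀ ρ) (hbi : 𝓜.Bivalent len D i (𝓜.run s₀ ρ))
    {p : Proc} {κ : K} (hp : 𝓜.app p κ ((𝓜.run s₀ ρ).loc p) (𝓜.run s₀ ρ).med) :
    ∃ τ c, ⟨p, κ, c⟩ ∈ τ ∧ 𝓜.Valid (𝓜.run s₀ ρ) τ ∧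
      𝓜.Bivalent len D i (𝓜.run (𝓜.run s₀ ρ) τ) := by
  by_contra! hcon
  set s := 𝓜.run s₀ ρ with hs
  let Av : List (Move Proc K) → Prop := fun σ => ∀ e ∈ σ, ¬ (e.proc = p ∧ e.kind = κ)
  have hcan : ∀ σ c, Av σ → 𝓜.Valid s σ → 𝓜.Can (𝓜.run s σ) ⟨p, κ, c⟩ := by
    intro σ c
    induction σ using List.reverseRecOn with
    | nil => exact fun _ _ => hp
    | append_singleton σ e ih =>
      intro ha hv
      simp only [valid_append, valid_cons, valid_nil, and_true] at hv
      have := hl.persists _ _ e (ih (fun e he => ha e (by simp [he])) hv.1) hv.2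
        (ha e (by simp))
      simpa using this
  have hex : ∀ σ, 𝓜.Valid s σ → ∀ q, ∃ v, 𝓜.ValWithout len D i q (𝓜.run s σ) v := by
    intro σ hσ q
    have := hgr.exists_valWithout (D := D) (i := i) (σ := ρ ++ σ) (by simp [hρ, ← hs, hσ]) q
    simpa [← hs] using this
  have huni : ∀ σ c, Av σ → 𝓜.Valid s σ → ∀ v w,
      𝓜.Val len D i (𝓜.apply (𝓜.run s σ) ⟨p, κ, c⟩) v →
      𝓜.Val len D i (𝓜.apply (𝓜.run s σ) ⟨p, κ, c⟩) w → v = w := by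
    intro σ c ha hσ v w hv hw
    by_contra hne
    refine hcon (σ ++ [⟨p, κ, c⟩]) c (by simp) (by simp [hσ, hcan σ c ha hσ])
      ⟨v, w, ?_, ?_, hne⟩ <;> simpa
  obtain ⟨u, hu⟩ := hex [⟨p, κ, true⟩] (by simpa using hcan [] true (by simp [Av]) (by simp)) p
  have hall : ∀ σ c, Av σ → 𝓜.Valid s σ →
      𝓜.Val len D i (𝓜.apply (𝓜.run s σ) ⟨p, κ, c⟩) u := by
    intro σ
    induction σ using List.reverseRecOn with
    | nil => exact fun c _ _ => (hu.of_sim hh (hh.sim_choice _ _ _ _ _)).val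
    | append_singleton σ e ih =>
      intro c ha hv
      have ha' : Av σ := fun e he => ha e (by simp [he])
      have hv' := hv
      simp only [valid_append, valid_cons, valid_nil, and_true] at hv'
      have hX := ih c ha' hv'.1
      have hc := hcan σ c ha' hv'.1
      have hce := hcan _ c ha hv
      simp only [run_append, run_cons, run_nil] at hce ⊢
      have hune := huni _ c ha hv
      simp only [run_append, run_cons, run_nil] at hune
      -- a value common to both neighbours is enough
      suffices hw : ∃ w, 𝓜.Val len D i (𝓜.apply (𝓜.run s σ) ⟨p, κ, c⟩) w ∧
          𝓜.Val len D i (𝓜.apply (𝓜.apply (𝓜.run s σ) e) ⟨p, κ, c⟩) w by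
        obtain ⟨w, hw1, hw2⟩ := hw
        rwa [huni σ c ha' hv'.1 u w hX hw1]
      have hexX := hex (σ ++ [⟨p, κ, c⟩]) (by simp [hv'.1, hc])
      have hexY := hex (σ ++ [e, ⟨p, κ, c⟩]) (by simp [hv'.1, hv'.2, hce])
      simp only [run_append, run_cons, run_nil] at hexX hexY
      -- the neighbours cannot be told apart without `e.proc`
      have hcase : Sim sim e.proc (𝓜.apply (𝓜.run s σ) ⟨p, κ, c⟩)
          (𝓜.apply (𝓜.apply (𝓜.run s σ) e) ⟨p, κ, c⟩) → ∃ w,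
          𝓜.Val len D i (𝓜.apply (𝓜.run s σ) ⟨p, κ, c⟩) w ∧
          𝓜.Val len D i (𝓜.apply (𝓜.apply (𝓜.run s σ) e) ⟨p, κ, c⟩) w := by
        intro hsim
        obtain ⟨w, hw⟩ := hexX e.proc
        exact ⟨w, hw.val, (hw.of_sim hh hsim).val⟩
      rcases hh.interplay with hN | ⟨hU, hD⟩
      · have hsim : ∀ t e', 𝓜.Can t e' → Sim sim e'.proc t (𝓜.apply t e') := fun t e' hce' =>
          ⟨fun q hq => (apply_loc_of_ne _ _ hq).symm, hN _ _ _ _ _ hce'⟩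
        by_cases hep : e.proc = p
        · obtain ⟨w, hw⟩ := hex σ hv'.1 p
          refine ⟨w, (hw.of_sim hh (hsim _ ⟨p, κ, c⟩ hc)).val, ?_⟩
          have := hw.of_sim hh (hep ▸ hsim _ e hv'.2)
          exact (this.of_sim hh (hsim _ ⟨p, κ, c⟩ hce)).val
        · exact hcase (hh.sim_apply (hsim _ e hv'.2) (Ne.symm hep) hc).2.2
      · by_cases hep : e.proc = p
        · have hk : e.kind = κ := by
            subst hep
            exact hU _ _ _ _ _ hv'.2 hc
          exact absurd ⟨hep, hk⟩ (ha e (by simp))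
        · rcases hD _ ⟨p, κ, c⟩ e hc hv'.2 (Ne.symm hep) with h1 | h1
          · exact hcase h1
          · obtain ⟨w, hw⟩ := hexY p
            refine ⟨w, ?_, hw.val⟩
            have hXe : 𝓜.Can (𝓜.apply (𝓜.run s σ) ⟨p, κ, c⟩) e :=
              hl.persists _ _ _ hv'.2 hc (fun hh => hep hh.1.symm)
            exact (hw.of_sim hh h1).val.of_apply hXe
  have hone : ∀ v, 𝓜.Val len D i s v → v = u := by
    rintro v ⟨τ, hτ, o, ho, hol, hov⟩
    -- if the move has been made when the value gets fixed, look at the state after it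
    have hafter : ∀ σ, 𝓜.Valid s σ → o ∈ 𝓜.outs s σ → 𝓜.Val len D i (𝓜.run s σ) u → v = u := by
      intro σ hσ hoσ hval
      rw [← hov]
      refine (hst.val_eq hre (σ := ρ ++ σ) (by simp [hρ, ← hs, hσ]) (o := o) ?_ hol ?_).symm
      · simp [← hs, hoσ]
      · simpa [← hs] using hval
    by_cases ha : Av τ
    · have hc := hcan τ true ha hτ
      refine hafter (τ ++ [⟨p, κ, true⟩]) (by simp [hτ, hc]) (by simp [ho]) ?_
      simpa using hall τ true ha hτ
    · obtain ⟨σ, c, τ', hsplit, hσ⟩ : ∃ σ c τ', τ = σ ++ ⟨p, κ, c⟩ :: τ' ∧ Av σ := by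
        clear hτ ho hafter
        induction τ with
        | nil => exact absurd (by simp [Av]) ha
        | cons e τ ih =>
          by_cases he : e.proc = p ∧ e.kind = κ
          · refine ⟨[], e.choice, τ, ?_, by simp [Av]⟩
            rw [← he.1, ← he.2]; rfl
          · obtain ⟨σ, c, τ', h1, h2⟩ := ih (fun hav => ha (by
              intro e' he'
              rcases List.mem_cons.1 he' with rfl | he'
              · exact he
              · exact hav e' he'))
            refine ⟨e :: σ, c, τ', by simp [h1], ?_⟩
            intro e' he'
            rcases List.mem_cons.1 he' with rfl | he'
            · exact he
            · exact h2 e' he'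
      subst hsplit
      simp only [valid_append, valid_cons] at hτ
      have hu' := hall σ c hσ hτ.1
      have ho' : o ∈ 𝓜.outs s (σ ++ [⟨p, κ, c⟩]) ∨
          o ∈ 𝓜.outs (𝓜.apply (𝓜.run s σ) ⟨p, κ, c⟩) τ' := by
        simpa [or_assoc] using ho
      rcases ho' with ho' | ho'
      · exact hafter _ (by simp [hτ.1, hτ.2.1]) ho' (by simpa using hu')
      · exact huni σ c hσ hτ.1 v u ⟨τ', hτ.2.2, o, ho', hol, hov⟩ hu'
  obtain ⟨v, w, hv, hw, hne⟩ := hbi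
  exact hne ((hone v hv).trans (hone w hw).symm)

end Valency

end Machine

namespace Machine

variable {Proc L M K O : Type*}

section Valency

variable {B : Type*} {g : B} {𝓜 : Machine Proc L M K (Blockchain B g)} {len : Blockchain B g → ℕ}
  {D i : ℕ} {s₀ : State Proc L M}

theorem Stable.sublist {log log' : List (Proc × Blockchain B g)} (h : Stable len D log')
    (hs : log.Sublist log') : Stable len D log :=
  fun x z y hx => h x z y (hx.trans hs)

theorem _root_.Blockchain.ext_blocks {bc bc' : Blockchain B g} (h : bc.blocks = bc'.blocks) :
    bc = bc' := by
  cases bc; cases bc'; cases h; rfl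

/-- If the new blocks depend on the choices, some position of the chains is not yet determined.
Otherwise, the chains that are read while all choices are `false` determine all positions; as
the chains have no repetitions, some position holds a block that is new and thus reveals the
choices, and this block is not available when all choices are `true`. -/
theorem exists_bivalent (hgr : 𝓜.Grows len s₀) [Nonempty Proc] (A : Finset B) (N : Bool → Set B)
    (hN : Disjoint (N false) (N true))
    (hA : ∀ c τ, 𝓜.Valid s₀ τ → (∀ e ∈ τ, e.choice = c) → ∀ o ∈ 𝓜.outs s₀ τ,
      ∀ b ∈ o.2.blocks, b ∈ A ∨ b ∈ N c) :
    ∃ i, 𝓜.Bivalent len D i s₀ := by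
  by_contra! hcon
  have huni : ∀ i v w, 𝓜.Val len D i s₀ v → 𝓜.Val len D i s₀ w → v = w := fun i v w hv hw => by
    by_contra hne
    exact hcon i ⟨v, w, hv, hw, hne⟩
  obtain ⟨p⟩ := ‹Nonempty Proc›
  have hget : ∀ c k, ∃ o : Proc × Blockchain B g, k < len o.2 ∧
      (∀ b ∈ o.2.blocks, b ∈ A ∨ b ∈ N c) ∧
      ∀ i, i + D ≤ len o.2 → 𝓜.Val len D i s₀ o.2.blocks[i]? := by
    intro c k
    obtain ⟨τ, h1, h2, o, ho, hk⟩ := hgr [] trivial p c k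
    exact ⟨o, hk, hA c τ h1 (fun e he => (h2 e he).2) o ho, fun i hi => ⟨τ, h1, o, ho, hi, rfl⟩⟩
  obtain ⟨o, hlen, hbl, hval, hlong⟩ : ∃ o : Proc × Blockchain B g, A.card + D < len o.2 ∧
      (∀ b ∈ o.2.blocks, b ∈ A ∨ b ∈ N false) ∧
      (∀ i, i + D ≤ len o.2 → 𝓜.Val len D i s₀ o.2.blocks[i]?) ∧
      A.card < o.2.blocks.length := by
    obtain ⟨o, ho, hb, hv⟩ := hget false (A.card + D)
    by_contra! hshort
    have h1 := hshort o ho hb hv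
    obtain ⟨o', ho', hb', hv'⟩ := hget false (len o.2)
    have h2 := hshort o' (ho.trans ho') hb' hv'
    have heq : o'.2 = o.2 := by
      apply Blockchain.ext_blocks
      apply List.ext_getElem?
      intro j
      rcases Nat.lt_or_ge j A.card with hj | hj
      · exact huni j _ _ (hv' j (by omega)) (hv j (by omega))
      · rw [List.getElem?_eq_none (h1.trans hj), List.getElem?_eq_none (h2.trans hj)]
    rw [heq] at ho'
    exact lt_irrefl _ ho'
  obtain ⟨b, hbmem, hbA⟩ : ∃ b ∈ o.2.blocks.take (A.card + 1), b ∉ A := by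
    classical
    by_contra! hsub
    have hcard := Finset.card_le_card
      (show (o.2.blocks.take (A.card + 1)).toFinset ⊆ A from fun b hb => hsub b (by simpa using hb))
    rw [List.toFinset_card_of_nodup (o.2.nodup.sublist (List.take_sublist _ _)),
      List.length_take] at hcard
    omega
  obtain ⟨j, hj, hjb⟩ := List.getElem_of_mem hbmem
  rw [List.length_take] at hj
  rw [List.getElem_take] at hjb
  have hob : o.2.blocks[j]? = some b := by
    rw [List.getElem?_eq_getElem (by omega), hjb]
  obtain ⟨o', hlen', hbl', hval'⟩ := hget true (A.card + D)
  have hob' : o'.2.blocks[j]? = some b := by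
    rw [← hob]
    exact huni j _ _ (hval' j (by omega)) (hval j (by omega))
  have hF := (hbl b (List.mem_of_mem_take hbmem)).resolve_left hbA
  have hT := (hbl' b (List.mem_of_getElem? hob')).resolve_left hbA
  exact Set.disjoint_left.1 hN hF hT

/-- A machine whose fair runs have reads with unbounded lengths and bounded displacement, which
makes progress even when one process stops, and whose new blocks depend on free choices, cannot
exist. If from each state the displacement can still get arbitrarily large, a fair run collects
larger and larger displacements. Otherwise the displacement is less than some `D` from some state
on, so long enough chains decide their early positions, and a fair run through bivalent states never
decides one of them. -/
theorem false_of_growth_of_stable [Countable Proc] [Nonempty Proc] (hl : 𝓜.Live)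
    {sim : Proc → M → M → Prop} (hh : 𝓜.Hides sim) (hre : 𝓜.Rereads s₀) (hgr : 𝓜.Grows len s₀)
    (N : Bool → Set B) (hN : Disjoint (N false) (N true))
    (hA : ∀ σ, 𝓜.Valid s₀ σ → ∃ A : Finset B, ∀ c τ, 𝓜.Valid (𝓜.run s₀ σ) τ →
      (∀ e ∈ τ, e.choice = c) → ∀ o ∈ 𝓜.outs (𝓜.run s₀ σ) τ, ∀ b ∈ o.2.blocks, b ∈ A ∨ b ∈ N c)
    (hfair : ∀ ev, 𝓜.IsRun s₀ ev → 𝓜.Fair s₀ Set.univ ev →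
      (∀ k, ∃ t x, 𝓜.output (𝓜.conf s₀ ev t) (ev t) = some x ∧ k < len x.2) ∧
      ∃ D, ∀ t, Stable len D (𝓜.outs s₀ (initial ev t))) :
    False := by
  by_cases hD : ∃ ρ D, 𝓜.Valid s₀ ρ ∧ 𝓜.StableFrom len D (𝓜.run s₀ ρ)
  · obtain ⟨ρ, D, hρ, hst⟩ := hD
    obtain ⟨A, hA⟩ := hA ρ hρ
    obtain ⟨i, hi⟩ := exists_bivalent (D := D) (hgr.run hρ) A N hN hA
    obtain ⟨ev, hrun, hfe, -, hbi⟩ := hl.exists_fair_run s₀ Set.univ_nonempty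
      (fun _ σ => ∃ τ, σ = ρ ++ τ ∧ 𝓜.Valid (𝓜.run s₀ ρ) τ ∧
        𝓜.Bivalent len D i (𝓜.run (𝓜.run s₀ ρ) τ)) ρ ⟨[], by simp, trivial, hi⟩
      (by rintro _ _ ⟨τ, rfl, h1, -⟩; simp [hρ, h1])
      (by
        rintro _ _ ⟨τ, rfl, h1, h2⟩ p - κ hap
        rw [run_append] at hap
        obtain ⟨τ', c, h3, h4, h5⟩ := exists_bivalent_extension hl hh hst (hre.run hρ)
          (hgr.run hρ) h1 h2 hap
        exact ⟨τ', c, h3, τ ++ τ', by simp, by simp [h1, h4], by simpa using h5⟩)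
    -- long enough to fix position `i`, and too long to be a chain read in `ρ`
    obtain ⟨t, x, hx, hk⟩ :=
      (hfair ev hrun hfe).1 (i + D + ((𝓜.outs s₀ ρ).map fun o => len o.2).sum)
    obtain ⟨t', ht', -, τ, hτ, hv, v, w, hvv, hww, hne⟩ := hbi (t + 1)
    have hmem : x ∈ 𝓜.outs s₀ (initial ev t') :=
      mem_outs_initial.2 ⟨t, ht', hx⟩
    rw [hτ, outs_append, List.mem_append] at hmem
    rcases hmem with hmem | hmem
    · have := List.le_sum_of_mem (List.mem_map_of_mem (f := fun o => len o.2) hmem)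
      omega
    · exact hne ((hst.val_eq (hre.run hρ) hv hmem (by omega) hvv).trans
        (hst.val_eq (hre.run hρ) hv hmem (by omega) hww).symm)
  · have hD' : ∀ ρ D, 𝓜.Valid s₀ ρ → ∃ τ, 𝓜.Valid (𝓜.run s₀ ρ) τ ∧
        ¬ Stable len D (𝓜.outs (𝓜.run s₀ ρ) τ) := by
      intro ρ D hρ
      by_contra! hcon
      exact hD ⟨ρ, D, hρ, hcon⟩
    obtain ⟨ev, hrun, hfe, -, hI⟩ := hl.exists_fair_run s₀ Set.univ_nonempty
      (fun n σ => 𝓜.Valid s₀ σ ∧ ∀ m, n = m + 1 → ¬ Stable len m (𝓜.outs s₀ σ)) []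
      ⟨trivial, fun m hm => by omega⟩ (fun _ _ h => h.1)
      (by
        rintro n σ ⟨h1, -⟩ p - κ hap
        have hv : 𝓜.Valid s₀ (σ ++ [⟨p, κ, true⟩]) := by
          rw [valid_append]
          exact ⟨h1, hap, trivial⟩
        obtain ⟨τ, h2, h3⟩ := hD' _ n hv
        refine ⟨⟨p, κ, true⟩ :: τ, true, List.mem_cons_self, ?_, ?_⟩
        · rw [List.append_cons, valid_append]
          exact ⟨hv, h2⟩
        · rintro m hm hs
          obtain rfl : n = m := by omega
          rw [List.append_cons, outs_append] at hs
          exact h3 (hs.sublist (List.sublist_append_right _ _)))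
    obtain ⟨-, D, hDs⟩ := hfair ev hrun hfe
    obtain ⟨t, -, -, -, ht⟩ := hI (D + 1)
    exact ht D rfl (hDs t)

end Valency

end Machine

namespace AsyncSystem

open Machine

variable {Proc : Type uP} {B : Type uB} {g : B}

/-! ### Driving a protocol with alternating reads and appends -/

/-- What is used of the two communication media: a Byzantine process can do nothing or act as a
correct one would, a step stays enabled until it is taken, and a process always has a step but only
countably many of them. -/
structure Regular (S : AsyncSystem.{uP, uB, u, v, w} Proc B g) : Prop where
  byz_refl : ∀ p m, S.byz p m m
  byz_step : ∀ p a l m, S.enabled p a m → S.byz p m (S.step p a l m).2.1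
  persists : ∀ p a p' a' l m, S.enabled p a m → S.enabled p' a' m → ¬ (p' = p ∧ a' = a) →
    S.enabled p a (S.step p' a' l m).2.1
  countable : ∀ p m, {a | S.enabled p a m}.Countable
  exists_enabled : ∀ p m, ∃ a, S.enabled p a m

/-- The local state of a process, its current operation, and the number of its calls so far. -/
structure LocalState (S : AsyncSystem.{uP, uB, u, v, w} Proc B g) where
  loc : S.Loc
  pend : Option (Call B)
  calls : ℕ

/-- The call number `n` of `p`: reads and appends alternate, and the block to be appended depends
on the choice `c`. -/
def nextCall (β : Proc → ℕ → Bool → B) (p : Proc) (n : ℕ) (c : Bool) : Call B :=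
  if Even n then .read else .append (β p n c)

variable (S : AsyncSystem.{uP, uB, u, v, w} Proc B g) (W : Prop) (β : Proc → ℕ → Bool → B)

open Classical in
/-- The current operation after a step with the output `o`, if it was `x` before. -/
noncomputable def pendAfter (o : Option (Reply B g)) (x : Option (Call B)) : Option (Call B) :=
  if ∃ r, o = some r ∧ ∃ c, x = some c ∧ r.Answers c then none else x

/-- The protocol together with its users as a machine without inputs. A move of kind `none` is a
call, which is possible when no operation is pending; a move of kind `some a` is a step of the
protocol. An idle process is allowed to make steps only if `W` holds. The outputs are the chains
that are read. -/
noncomputable def driven :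
    Machine Proc S.LocalState S.Med (Option S.Kind) (Blockchain B g) where
  app p κ l m := match κ with
    | none => l.pend = none
    | some a => S.enabled p a m ∧ (W ∨ l.pend ≠ none)
  next p κ c l m := match κ with
    | none => (⟨S.invoke p l.loc (nextCall β p l.calls c), some (nextCall β p l.calls c),
        l.calls + 1⟩, m)
    | some a => (⟨(S.step p a l.loc m).1,
        pendAfter (S.step p a l.loc m).2.2 l.pend, l.calls⟩, (S.step p a l.loc m).2.1)
  out p κ l m := match κ with
    | none => none
    | some a => match (S.step p a l.loc m).2.2, l.pend with
      | some (.read bc), some .read => some bc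
      | _, _ => none

/-- The initial state of the machine. -/
def drivenInit : State Proc S.LocalState S.Med where
  loc p := ⟨S.init p, none, 0⟩
  med := S.med₀

variable {S W β}

section Driven

local notation "𝓓" => S.driven W β

/-- The effect of a move on the interface of the process `q`: nothing, a call, or a response. -/
theorem driven_cases {s : State Proc S.LocalState S.Med} {e : Move Proc (Option S.Kind)}
    (he : (𝓓).Can s e) (q : Proc) :
    ((((𝓓).apply s e).loc q).pend = (s.loc q).pend ∧
      (((𝓓).apply s e).loc q).calls = (s.loc q).calls) ∨
    (e.proc = q ∧ e.kind = none ∧ (s.loc q).pend = none ∧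
      (((𝓓).apply s e).loc q).pend = some (nextCall β q (s.loc q).calls e.choice) ∧
      (((𝓓).apply s e).loc q).calls = (s.loc q).calls + 1) ∨
    (e.proc = q ∧ ∃ a, e.kind = some a ∧ (((𝓓).apply s e).loc q).pend = none ∧
      (((𝓓).apply s e).loc q).calls = (s.loc q).calls ∧
      ∃ r, (S.step q a (s.loc q).loc s.med).2.2 = some r ∧
        ∃ c, (s.loc q).pend = some c ∧ r.Answers c) := by
  obtain ⟨p, κ, c⟩ := e
  by_cases hq : q = p
  · subst hq
    cases κ with
    | none =>
      refine Or.inr (Or.inl ⟨rfl, rfl, he, ?_, ?_⟩) <;> rw [apply_loc_self] <;> rfl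
    | some a =>
      by_cases hr : ∃ r, (S.step q a (s.loc q).loc s.med).2.2 = some r ∧
        ∃ c, (s.loc q).pend = some c ∧ r.Answers c
      · refine Or.inr (Or.inr ⟨rfl, a, rfl, ?_, ?_, hr⟩) <;> rw [apply_loc_self]
        · exact if_pos hr
        · rfl
      · refine Or.inl ⟨?_, ?_⟩ <;> rw [apply_loc_self]
        · exact if_neg hr
        · rfl
  · rw [apply_loc_of_ne _ _ hq]
    exact Or.inl ⟨rfl, rfl⟩

theorem driven_output_eq_some {s : State Proc S.LocalState S.Med}
    {e : Move Proc (Option S.Kind)} {x : Proc × Blockchain B g} :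
    (𝓓).output s e = some x ↔ e.proc = x.1 ∧ ∃ a, e.kind = some a ∧
      (S.step x.1 a (s.loc x.1).loc s.med).2.2 = some (.read x.2) ∧
      (s.loc x.1).pend = some .read := by
  obtain ⟨p, κ, c⟩ := e
  obtain ⟨q, bc⟩ := x
  cases κ with
  | none => simp [output, driven]
  | some a =>
    simp only [output, driven, Option.map_eq_some_iff, Prod.mk.injEq, Option.some.injEq,
      exists_eq_left']
    constructor
    · rintro ⟨bc', h, rfl, rfl⟩
      split at h
      · rename_i h1 h2
        obtain rfl := Option.some.inj h
        exact ⟨rfl, h1, h2⟩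
      · exact absurd h (by simp)
    · rintro ⟨rfl, h1, h2⟩
      exact ⟨bc, by simp [h1, h2], rfl, rfl⟩

theorem driven_pend_of_output {s : State Proc S.LocalState S.Med}
    {e : Move Proc (Option S.Kind)} {x : Proc × Blockchain B g} (h : (𝓓).output s e = some x) :
    (((𝓓).apply s e).loc x.1).pend = none := by
  obtain ⟨h1, a, h2, h3, h4⟩ := driven_output_eq_some.1 h
  rw [← h1, apply_loc_self, h1, h2]
  exact if_pos ⟨_, h3, _, h4, trivial⟩

theorem driven_live (hS : S.Regular) (hW : W ∨ Subsingleton S.Kind) : (𝓓).Live where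
  persists := by
    rintro s ⟨p, κ, c⟩ ⟨p', κ', c'⟩ h h' hne
    have hcases := driven_cases h' p
    cases κ with
    | none =>
      have hp : (s.loc p).pend = none := h
      change (((𝓓).apply s _).loc p).pend = none
      rcases hcases with h1 | ⟨h1, h2, -⟩ | ⟨-, a, -, h2, -⟩
      · rw [h1.1, hp]
      · exact absurd ⟨h1, h2⟩ hne
      · exact h2
    | some a =>
      obtain ⟨he, hw⟩ : S.enabled p a s.med ∧ (W ∨ (s.loc p).pend ≠ none) := h
      constructor
      · cases κ' with
        | none => exact he
        | some a' =>
          exact hS.persists _ _ _ _ _ _ he h'.1 (fun hh => hne ⟨hh.1, congrArg some hh.2⟩)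
      · rcases hW with hW | hW
        · exact Or.inl hW
        · rcases hw with hw | hw
          · exact Or.inl hw
          · rcases hcases with h1 | ⟨-, -, h1, -⟩ | ⟨h1, a', h2, -⟩
            · exact Or.inr (h1.1 ▸ hw)
            · exact absurd h1 hw
            · exact absurd ⟨h1, by simpa [Subsingleton.elim a a'] using h2⟩ hne
  countable p l m := by
    refine (((hS.countable p m).image some).insert none).mono ?_
    rintro (_ | a) h
    · exact Set.mem_insert _ _
    · exact Set.mem_insert_of_mem _ ⟨a, h.1, rfl⟩
  exists_app p l m := by
    by_cases hl : l.pend = none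
    · exact ⟨none, hl⟩
    · obtain ⟨a, ha⟩ := hS.exists_enabled p m
      exact ⟨some a, ha, Or.inr hl⟩

/-! ### Executions in which the Byzantine processes look correct to the others -/

/-- The configuration of an execution in which the processes of `F` are Byzantine and imitate
correct processes: their local states are forgotten. -/
def toConfig (F : Finset Proc) [DecidablePred (· ∈ F)] (s : State Proc S.LocalState S.Med) :
    S.Config where
  loc q := if q ∈ F then S.init q else (s.loc q).loc
  pend q := if q ∈ F then none else (s.loc q).pend
  med := s.med

/-- The action that corresponds to a move when the processes of `F` are Byzantine. -/
def toAction (β : Proc → ℕ → Bool → B) (F : Finset Proc) [DecidablePred (· ∈ F)]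
    (s : State Proc S.LocalState S.Med) (e : Move Proc (Option S.Kind)) : S.Action :=
  if e.proc ∈ F then .byz e.proc else
    match e.kind with
    | none => .call e.proc (nextCall β e.proc (s.loc e.proc).calls e.choice)
    | some a => .step e.proc a

variable {F : Finset Proc} [DecidablePred (· ∈ F)]

theorem toAction_eq_call {s : State Proc S.LocalState S.Med} {e : Move Proc (Option S.Kind)}
    {p : Proc} {c : Call B} : toAction β F s e = .call p c ↔
      p ∉ F ∧ e.proc = p ∧ e.kind = none ∧ c = nextCall β p (s.loc p).calls e.choice := by
  obtain ⟨q, κ, c'⟩ := e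
  by_cases hq : q ∈ F <;> cases κ <;> simp only [toAction, hq] <;> simp <;> grind

theorem toAction_eq_step {s : State Proc S.LocalState S.Med} {e : Move Proc (Option S.Kind)}
    {p : Proc} {a : S.Kind} : toAction β F s e = .step p a ↔
      p ∉ F ∧ e.proc = p ∧ e.kind = some a := by
  obtain ⟨q, κ, c'⟩ := e
  by_cases hq : q ∈ F <;> cases κ <;> simp only [toAction, hq] <;> simp <;> grind

theorem responds_toConfig {s : State Proc S.LocalState S.Med} {p : Proc} (hp : p ∉ F)
    {a : S.Kind} {r : Reply B g} : S.Responds (toConfig F s) p a r ↔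
      (S.step p a (s.loc p).loc s.med).2.2 = some r ∧
        ∃ c, (s.loc p).pend = some c ∧ r.Answers c := by
  simp [Responds, toConfig, hp]

theorem transition_toConfig (hS : S.Regular) {s : State Proc S.LocalState S.Med}
    {e : Move Proc (Option S.Kind)} (he : (𝓓).Can s e) :
    S.Transition F (toConfig F s) (toAction β F s e) (toConfig F ((𝓓).apply s e)) := by
  obtain ⟨p, κ, c⟩ := e
  have hother : ∀ q, q ≠ p → ((𝓓).apply s ⟨p, κ, c⟩).loc q = s.loc q :=
    fun q hq => apply_loc_of_ne _ _ hq
  by_cases hp : p ∈ F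
  · have hact : toAction β F s (⟨p, κ, c⟩ : Move Proc (Option S.Kind)) = .byz p := by
      simp [toAction, hp]
    rw [hact]
    refine ⟨hp, ?_, ?_, ?_⟩
    · cases κ with
      | none => exact hS.byz_refl _ _
      | some a => exact hS.byz_step _ _ _ _ he.1
    all_goals
      funext q
      by_cases hq : q ∈ F
      · simp [toConfig, hq]
      · simp [toConfig, hq, hother q (fun h => hq (h ▸ hp))]
  · cases κ with
    | none =>
      rw [toAction_eq_call.2 ⟨hp, rfl, rfl, rfl⟩]
      refine ⟨hp, ?_, ?_, ?_, ?_, rfl⟩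
      · have : (s.loc p).pend = none := he
        simp [toConfig, this]
      · simp [toConfig, hp, driven, apply]
      · simp [toConfig, hp, driven, apply]
      · intro q hq
        simp [toConfig, hother q hq]
    | some a =>
      rw [toAction_eq_step.2 ⟨hp, rfl, rfl⟩]
      refine ⟨hp, he.1, ?_, ?_, ?_, ?_, ?_⟩
      · simp [toConfig, hp, driven, apply]
      · simp [toConfig, hp, driven, apply]
      · intro hr
        simp only [responds_toConfig hp] at hr
        simp only [toConfig, hp, apply, driven, if_false, Function.update_self]
        exact if_pos hr
      · intro hr
        simp only [responds_toConfig hp] at hr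
        simp only [toConfig, hp, apply, driven, if_false, Function.update_self]
        exact if_neg hr
      · intro q hq
        simp [toConfig, hother q hq]

theorem calls_mono {s : State Proc S.LocalState S.Med} {ev : ℕ → Move Proc (Option S.Kind)}
    (hr : (𝓓).IsRun s ev) (p : Proc) :
    Monotone fun t => (((𝓓).conf s ev t).loc p).calls := by
  refine monotone_nat_of_le_succ fun t => ?_
  rw [conf_succ]
  rcases driven_cases (hr t) p with h | ⟨-, -, -, -, h⟩ | ⟨-, a, -, -, h, -⟩ <;> omega

theorem calls_succ {s : State Proc S.LocalState S.Med} {ev : ℕ → Move Proc (Option S.Kind)}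
    {p : Proc} {t : ℕ} (h1 : (ev t).proc = p) (h2 : (ev t).kind = none) :
    (((𝓓).conf s ev (t + 1)).loc p).calls = (((𝓓).conf s ev t).loc p).calls + 1 := by
  rw [conf_succ, ← h1, apply_loc_self, h2]
  rfl

theorem calls_le {ev : ℕ → Move Proc (Option S.Kind)} (hr : (𝓓).IsRun S.drivenInit ev)
    (p : Proc) (t : ℕ) : (((𝓓).conf S.drivenInit ev t).loc p).calls ≤ t := by
  induction t with
  | zero => exact le_rfl
  | succ t ih =>
    rw [conf_succ]
    rcases driven_cases (hr t) p with h | ⟨-, -, -, -, h⟩ | ⟨-, a, -, -, h, -⟩ <;> omega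

/-- No block is the genesis block, and different calls or choices have different blocks. -/
structure Supply (g : B) (β : Proc → ℕ → Bool → B) : Prop where
  ne : ∀ p n c, β p n c ≠ g
  inj : ∀ {p n c p' n' c'}, β p n c = β p' n' c' → p = p' ∧ n = n' ∧ c = c'

theorem nextCall_eq_append {p : Proc} {n : ℕ} {c : Bool} {b : B} :
    nextCall β p n c = .append b ↔ ¬ Even n ∧ β p n c = b := by
  unfold nextCall
  split_ifs with h <;> simp [h]

/-- A run that is fair for the processes outside `F` is an execution in which the processes of `F`
are Byzantine. -/
noncomputable def toExecution (hS : S.Regular) (hβ : Supply g β)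
    (ev : ℕ → Move Proc (Option S.Kind)) (hr : (𝓓).IsRun S.drivenInit ev)
    (hf : (𝓓).Fair S.drivenInit {p | p ∉ F} ev) : S.Execution F where
  conf t := toConfig F ((𝓓).conf S.drivenInit ev t)
  act t := toAction β F ((𝓓).conf S.drivenInit ev t) (ev t)
  conf_zero := by
    simp only [conf_zero, drivenInit, toConfig, initConfig, ite_self]
  trans t := by
    rw [conf_succ]
    exact transition_toConfig hS (hr t)
  fair := by
    intro p hp a t ha
    simp only [toAction_eq_step]
    by_contra! hcon
    have hen : ∀ t', t ≤ t' → S.enabled p a ((𝓓).conf S.drivenInit ev t').med := by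
      intro t' ht'
      induction t', ht' using Nat.le_induction with
      | base => exact ha
      | succ n hn ih =>
        rw [conf_succ]
        have hc := hr n
        have hcn := hcon n hn hp
        revert hc hcn
        rcases ev n with ⟨q, _ | a', c⟩
        · exact fun _ _ => ih
        · intro hc hcn
          exact hS.persists _ _ _ _ _ _ ih hc.1 (fun hh => hcn hh.1 (congrArg some hh.2))
    have hno : ∀ t', t ≤ t' → ¬ (W ∨ (((𝓓).conf S.drivenInit ev t').loc p).pend ≠ none) := by
      intro t' ht' hw
      obtain ⟨t'', h1, h2, h3⟩ := hf p hp (some a) t' ⟨hen t' ht', hw⟩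
      exact hcon t'' (ht'.trans h1) hp h2 h3
    -- an idle process makes a call, and then it is not idle
    have hidle := hno t le_rfl
    push Not at hidle
    obtain ⟨t', h1, h2, h3⟩ := hf p hp none t hidle.2
    have hcall := hno (t' + 1) (by omega)
    push Not at hcall
    rw [conf_succ, ← h2, apply_loc_self, h3] at hcall
    exact absurd hcall.2 (by simp [driven])
  append_ne := by
    intro t p b h
    obtain ⟨-, -, -, h⟩ := toAction_eq_call.1 h
    obtain ⟨-, rfl⟩ := nextCall_eq_append.1 h.symm
    exact hβ.ne _ _ _
  append_unique := by
    have hlt : ∀ t t' p p' b,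
        toAction β F ((𝓓).conf S.drivenInit ev t) (ev t) = .call p (.append b) →
        toAction β F ((𝓓).conf S.drivenInit ev t') (ev t') = .call p' (.append b) → ¬ t < t' := by
      intro t t' p p' b h h' hlt
      obtain ⟨-, h1, h2, h3⟩ := toAction_eq_call.1 h
      obtain ⟨-, -, -, h3'⟩ := toAction_eq_call.1 h'
      obtain ⟨-, h4⟩ := nextCall_eq_append.1 h3.symm
      obtain ⟨-, h4'⟩ := nextCall_eq_append.1 h3'.symm
      obtain ⟨rfl, h5, -⟩ := hβ.inj (h4.trans h4'.symm)
      have h6 := calls_mono hr p (Nat.succ_le_of_lt hlt)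
      have h7 := calls_succ (W := W) (β := β) (s := S.drivenInit) h1 h2
      simp only [Nat.succ_eq_add_one] at h6
      omega
    intro t t' p p' b h h'
    rcases lt_trichotomy t t' with hl | hl | hl
    · exact absurd hl (hlt _ _ _ _ _ h h')
    · exact hl
    · exact absurd hl (hlt _ _ _ _ _ h' h)

end Driven

end AsyncSystem

namespace AsyncSystem

open Machine

variable {Proc : Type uP} {B : Type uB} {g : B}
variable {S : AsyncSystem.{uP, uB, u, v, w} Proc B g} {W : Prop} {β : Proc → ℕ → Bool → B}

section History

local notation "𝓓" => S.driven W β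

variable {F : Finset Proc} [DecidablePred (· ∈ F)] {hS : S.Regular} {hβ : Supply g β}
  {ev : ℕ → Move Proc (Option S.Kind)} {hr : (S.driven W β).IsRun S.drivenInit ev}
  {hf : (S.driven W β).Fair S.drivenInit {p | p ∉ F} ev}

local notation "𝓒" => Machine.conf (AsyncSystem.driven S W β) (AsyncSystem.drivenInit S) ev

/-! ### Histories of driven runs -/

theorem produces_inv {q : Proc} (hq : q ∉ F) {t : ℕ} {c : Call B} :
    (toExecution (F := F) hS hβ ev hr hf).Produces ⟨t, q, .inv c⟩ ↔
      (ev t).proc = q ∧ (ev t).kind = none ∧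
        c = nextCall β q ((𝓒 t).loc q).calls (ev t).choice := by
  simp only [Execution.Produces, toExecution, toAction_eq_call]
  simp [hq]

theorem produces_rsp {q : Proc} (hq : q ∉ F) {t : ℕ} {r : Reply B g} :
    (toExecution (F := F) hS hβ ev hr hf).Produces ⟨t, q, .rsp r⟩ ↔
      (ev t).proc = q ∧ ∃ a, (ev t).kind = some a ∧
        (S.step q a ((𝓒 t).loc q).loc (𝓒 t).med).2.2 = some r ∧
          ∃ c, ((𝓒 t).loc q).pend = some c ∧ r.Answers c := by
  simp only [Execution.Produces, toExecution, toAction_eq_step, responds_toConfig hq]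
  simp [hq, and_assoc]

theorem produces_read {q : Proc} (hq : q ∉ F) {t : ℕ} {bc : Blockchain B g} :
    (toExecution (F := F) hS hβ ev hr hf).Produces ⟨t, q, .rsp (.read bc)⟩ ↔
      (𝓓).output (𝓒 t) (ev t) = some (q, bc) := by
  rw [produces_rsp hq, driven_output_eq_some]
  refine and_congr_right fun _ => exists_congr fun a => and_congr_right fun _ =>
    and_congr_right fun _ => ⟨?_, fun h => ⟨_, h, trivial⟩⟩
  rintro ⟨_ | _, h, ha⟩
  · exact ha.elim
  · exact h

theorem isRead_iff {H : History Proc B g} (hH : (toExecution (F := F) hS hβ ev hr hf).IsHistory H)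
    {r : Event Proc B g} {bc : Blockchain B g} :
    H.IsRead r bc ↔ ∃ t q, q ∉ F ∧ r = ⟨t, q, .rsp (.read bc)⟩ ∧
      (𝓓).output (𝓒 t) (ev t) = some (q, bc) := by
  constructor
  · rintro ⟨hr, hl⟩
    obtain ⟨t, q, l⟩ := r
    obtain rfl : l = .rsp (.read bc) := hl
    by_cases hq : q ∈ F
    · obtain ⟨b, hb⟩ := hH.2 _ hr hq
      exact absurd hb (by simp)
    · exact ⟨t, q, hq, rfl, (produces_read hq).1 ((hH.1 _ hq).1 hr)⟩
  · rintro ⟨t, q, hq, rfl, ho⟩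
    exact ⟨(hH.1 _ hq).2 ((produces_read hq).2 ho), rfl⟩

/-- Correct processes make infinitely many calls. -/
theorem exists_call (hT : (toExecution (F := F) hS hβ ev hr hf).Terminates) {q : Proc} (hq : q ∉ F)
    (n : ℕ) : ∃ t, (ev t).proc = q ∧ (ev t).kind = none ∧ ((𝓒 t).loc q).calls = n := by
  have hnext : ∀ t, ∃ t', t ≤ t' ∧ (ev t').proc = q ∧ (ev t').kind = none := by
    intro t
    obtain ⟨t', ht', hn⟩ : ∃ t', t ≤ t' ∧ ((𝓒 t').loc q).pend = none := by
      by_cases h : ((𝓒 t).loc q).pend = none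
      · exact ⟨t, le_rfl, h⟩
      · obtain ⟨t', h1, h2⟩ := hT q hq t (by simpa [toExecution, toConfig, hq] using h)
        exact ⟨t', h1, by simpa [toExecution, toConfig, hq] using h2⟩
    obtain ⟨t'', h1, h2⟩ := hf q hq none t' hn
    exact ⟨t'', ht'.trans h1, h2⟩
  have hunb : ∀ n, ∃ t, n ≤ ((𝓒 t).loc q).calls := by
    intro n
    induction n with
    | zero => exact ⟨0, Nat.zero_le _⟩
    | succ n ih =>
      obtain ⟨t, ht⟩ := ih
      obtain ⟨t', h1, h2, h3⟩ := hnext t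
      refine ⟨t' + 1, ?_⟩
      have h4 := calls_mono hr q h1
      have h5 := calls_succ (W := W) (β := β) (s := S.drivenInit) h2 h3
      simp only at h4
      omega
  -- the last time at which `n` calls have been made
  classical
  have hn := hunb (n + 1)
  have h0 : Nat.find hn ≠ 0 := by
    intro h
    have := Nat.find_spec hn
    rw [h] at this
    exact absurd this (by simp [drivenInit])
  obtain ⟨t, ht⟩ := Nat.exists_eq_succ_of_ne_zero h0
  have h1 := Nat.find_min hn (m := t) (by omega)
  have h2 := Nat.find_spec hn
  rw [ht, Nat.succ_eq_add_one, conf_succ] at h2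
  rcases driven_cases (hr t) q with h | ⟨h3, h4, -⟩ | ⟨-, a, -, -, h, -⟩
  · omega
  · refine ⟨t, h3, h4, ?_⟩
    have h5 := calls_succ (W := W) (β := β) (s := S.drivenInit) h3 h4
    rw [conf_succ] at h5
    omega
  · omega

/-- Correct processes get infinitely many responses. -/
theorem exists_response (hT : (toExecution (F := F) hS hβ ev hr hf).Terminates) {q : Proc}
    (hq : q ∉ F) (n : ℕ) : ∃ t r c, (toExecution (F := F) hS hβ ev hr hf).Produces ⟨t, q, .rsp r⟩ ∧
      r.Answers (nextCall β q n c) ∧ ((𝓒 t).loc q).calls = n + 1 := by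
  obtain ⟨t, h1, h2, h3⟩ := exists_call hT hq n
  have hpend : ((𝓒 (t + 1)).loc q).pend = some (nextCall β q n (ev t).choice) := by
    rw [conf_succ, ← h1, apply_loc_self, h2, h1, ← h3]
    rfl
  have hcalls : ((𝓒 (t + 1)).loc q).calls = n + 1 := by
    rw [calls_succ h1 h2, h3]
  by_contra! hcon
  have hall : ∀ t', t + 1 ≤ t' →
      ((𝓒 t').loc q).pend = some (nextCall β q n (ev t).choice) ∧
        ((𝓒 t').loc q).calls = n + 1 := by
    intro t' ht'
    induction t', ht' using Nat.le_induction with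
    | base => exact ⟨hpend, hcalls⟩
    | succ k _ ih =>
      rw [conf_succ]
      rcases driven_cases (hr k) q with h | ⟨-, -, h, -⟩ | ⟨h3, a, h4, -, -, r, h5, c, h6, h7⟩
      · rw [h.1, h.2]; exact ih
      · rw [ih.1] at h; exact absurd h (by simp)
      · refine absurd ih.2 (hcon k r (ev t).choice ?_ ?_)
        · exact (produces_rsp hq).2 ⟨h3, a, h4, h5, c, h6, h7⟩
        · rw [ih.1] at h6
          rwa [Option.some.inj h6]
  obtain ⟨t', h4, h5⟩ := hT q hq (t + 1) (by simp [toExecution, toConfig, hq, hpend])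
  have h6 := (hall t' h4).1
  simp [toExecution, toConfig, hq, h6] at h5

theorem exists_read (hT : (toExecution (F := F) hS hβ ev hr hf).Terminates) {q : Proc} (hq : q ∉ F)
    (n : ℕ) : ∃ t bc, (𝓓).output (𝓒 t) (ev t) = some (q, bc) ∧
      ((𝓒 t).loc q).calls = 2 * n + 1 := by
  obtain ⟨t, r, c, h1, h2, h3⟩ := exists_response hT hq (2 * n)
  rw [nextCall, if_pos (even_two_mul n)] at h2
  cases r with
  | append ok => exact h2.elim
  | read bc => exact ⟨t, bc, (produces_read hq).1 h1, h3⟩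

theorem infinitelyManyReads (hT : (toExecution (F := F) hS hβ ev hr hf).Terminates) {q : Proc}
    (hq : q ∉ F) {H : History Proc B g} (hH : (toExecution (F := F) hS hβ ev hr hf).IsHistory H) :
    H.InfinitelyManyReads := by
  constructor
  · choose t h1 h2 h3 using fun n => exists_call hT hq (2 * n)
    refine Set.infinite_of_injective_forall_mem (f := fun n => ⟨t n, q, .inv .read⟩) ?_ ?_
    · intro m n hmn
      have h4 := h3 m
      rw [(Event.mk.inj hmn).1, h3 n] at h4
      omega
    · intro n
      refine ⟨(hH.1 _ hq).2 ((produces_inv hq).2 ⟨h1 n, h2 n, ?_⟩), rfl⟩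
      rw [h3, nextCall, if_pos (even_two_mul n)]
  · choose t bc h1 h2 using exists_read hT hq
    refine Set.infinite_of_injective_forall_mem (f := fun n => ⟨t n, q, .rsp (.read (bc n))⟩) ?_ ?_
    · intro m n hmn
      have h4 := h2 m
      rw [(Event.mk.inj hmn).1, h2 n] at h4
      omega
    · intro n
      exact ⟨bc n, (isRead_iff hH).2 ⟨t n, q, hq, rfl, h1 n⟩⟩

theorem infinitelyManyAppends (hT : (toExecution (F := F) hS hβ ev hr hf).Terminates) {q : Proc}
    (hq : q ∉ F) {H : History Proc B g} (hH : (toExecution (F := F) hS hβ ev hr hf).IsHistory H) :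
    H.InfinitelyManyAppends := by
  have hodd : ∀ n, ¬ Even (2 * n + 1) := fun n => by simp
  constructor
  · choose t h1 h2 h3 using fun n => exists_call hT hq (2 * n + 1)
    refine Set.infinite_of_injective_forall_mem
      (f := fun n => ⟨t n, q, .inv (.append (β q (2 * n + 1) (ev (t n)).choice))⟩) ?_ ?_
    · intro m n hmn
      have h4 := h3 m
      rw [(Event.mk.inj hmn).1, h3 n] at h4
      omega
    · intro n
      refine ⟨_, (hH.1 _ hq).2 ((produces_inv hq).2 ⟨h1 n, h2 n, ?_⟩), rfl⟩
      rw [h3, nextCall, if_neg (hodd n)]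
  · choose t r c h1 h2 h3 using fun n => exists_response hT hq (2 * n + 1)
    refine Set.infinite_of_injective_forall_mem (f := fun n => ⟨t n, q, .rsp (r n)⟩) ?_ ?_
    · intro m n hmn
      have h4 := h3 m
      rw [(Event.mk.inj hmn).1, h3 n] at h4
      omega
    · intro n
      refine ⟨(hH.1 _ hq).2 (h1 n), ?_⟩
      have h4 := h2 n
      rw [nextCall, if_neg (hodd n)] at h4
      cases hrn : r n with
      | append ok => exact ⟨ok, rfl⟩
      | read bc => rw [hrn] at h4; exact h4.elim

/-- Chains of unbounded length are read in a run that is fair for the correct processes. -/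
theorem exists_long_read {P : Blockchain B g → Prop} {len : Blockchain B g → ℕ} {f : ℕ}
    (hsol : S.SolvesUBDEP P len f) (hS : S.Regular) (hβ : Supply g β) (hF : F.card ≤ f)
    (hr : (𝓓).IsRun S.drivenInit ev) (hf : (𝓓).Fair S.drivenInit {p | p ∉ F} ev) {q : Proc}
    (hq : q ∉ F) (k : ℕ) : ∃ t x, (𝓓).output (𝓒 t) (ev t) = some x ∧ k < len x.2 := by
  obtain ⟨hT, H, hH, ⟨-, -, -, hgrow⟩, -⟩ := hsol F hF (toExecution (F := F) hS hβ ev hr hf)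
  obtain ⟨r, bc, hrd, hk⟩ := hgrow (infinitelyManyAppends hT hq hH)
    (infinitelyManyReads hT hq hH) k
  obtain ⟨t, q', -, -, ho⟩ := (isRead_iff hH).1 hrd
  exact ⟨t, _, ho, hk⟩

/-- Between a response of `q` and a moment at which an operation `c` of `q` is pending, `c` is
called. -/
theorem exists_call_between {q : Proc} {t t' : ℕ} (hr : (𝓓).IsRun S.drivenInit ev) (ht : t ≤ t')
    (hn : ((𝓒 t).loc q).pend = none) {c : Call B} (hc : ((𝓒 t').loc q).pend = some c) :
    ∃ k, t ≤ k ∧ k < t' ∧ (ev k).proc = q ∧ (ev k).kind = none ∧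
      c = nextCall β q ((𝓒 k).loc q).calls (ev k).choice := by
  induction t', ht using Nat.le_induction with
  | base => rw [hn] at hc; exact absurd hc (by simp)
  | succ n hle ih =>
    rw [conf_succ] at hc
    rcases driven_cases (hr n) q with h | ⟨h1, h2, -, h3, -⟩ | ⟨-, a, -, h, -⟩
    · obtain ⟨k, h1, h2, h3⟩ := ih (h.1 ▸ hc)
      exact ⟨k, h1, by omega, h3⟩
    · rw [h3] at hc
      exact ⟨n, hle, by omega, h1, h2, (Option.some.inj hc).symm⟩
    · rw [h] at hc; exact absurd hc (by simp)

end History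

/-! ### Consequences of solving the problem -/

section Solves

local notation "𝓓" => S.driven W β

variable {ev : ℕ → Move Proc (Option S.Kind)} {P : Blockchain B g → Prop}
  {len : Blockchain B g → ℕ} {f : ℕ}

/-- Without Byzantine processes, the displacement in a fair run is bounded. -/
theorem exists_stable (hsol : S.SolvesUBDEP P len f) (hS : S.Regular) (hβ : Supply g β)
    (hr : (𝓓).IsRun S.drivenInit ev) (hf : (𝓓).Fair S.drivenInit Set.univ ev) :
    ∃ D, ∀ t, Stable len D ((𝓓).outs S.drivenInit (initial ev t)) := by
  classical
  have hf' : (𝓓).Fair S.drivenInit {p | p ∉ (∅ : Finset Proc)} ev := fun p _ => hf p trivial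
  obtain ⟨-, H, hH, -, D, hD⟩ := hsol ∅ (by simp) (toExecution hS hβ ev hr hf')
  refine ⟨D, ?_⟩
  rintro t ⟨p, b₁⟩ ⟨q, b₂⟩ ⟨q', b₃⟩ hsub hq i hi
  obtain rfl : q = q' := hq
  obtain ⟨t₃, -, hy, hsub⟩ := sublist_outs_initial (l := [_, _]) hsub
  obtain ⟨t₂, ht₂, hz, hsub⟩ := sublist_outs_initial (l := [_]) hsub
  obtain ⟨t₁, ht₁, hx, -⟩ := sublist_outs_initial (l := []) hsub
  have hRx := (isRead_iff hH).2 ⟨t₁, p, Finset.notMem_empty p, rfl, hx⟩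
  have hRy := (isRead_iff hH).2 ⟨t₃, q, Finset.notMem_empty q, rfl, hy⟩
  have hidle : (((𝓓).conf S.drivenInit ev (t₂ + 1)).loc q).pend = none := by
    rw [conf_succ]
    exact driven_pend_of_output hz
  obtain ⟨-, a, -, -, hpend⟩ := driven_output_eq_some.1 hy
  -- the call of the read `y` follows the response of the read `x`
  obtain ⟨k, hk1, hk2, hk3, hk4, hk5⟩ :=
    exists_call_between hr (Nat.succ_le_of_lt ht₂) hidle hpend
  have hinv : (⟨k, q, .inv .read⟩ : Event Proc B g) ∈ H :=
    (hH.1 _ (Finset.notMem_empty q)).2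
      ((produces_inv (Finset.notMem_empty q)).2 ⟨hk3, hk4, hk5⟩)
  refine hD _ b₁ _ b₃ hRx hRy ?_ i hi
  refine (Relation.TransGen.single ⟨hRx.1, hinv, Or.inr ⟨⟨_, rfl⟩, ⟨_, rfl⟩, ?_⟩⟩).tail
    ⟨hinv, hRy.1, Or.inl ⟨rfl, hk2⟩⟩
  change t₁ < k
  omega

theorem exists_fair_extension [Countable Proc] [Nonempty Proc] (hl : (𝓓).Live)
    {σ : List (Move Proc (Option S.Kind))} (hσ : (𝓓).Valid S.drivenInit σ) :
    ∃ ev, (𝓓).IsRun S.drivenInit ev ∧ (𝓓).Fair S.drivenInit Set.univ ev ∧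
      initial ev σ.length = σ := by
  obtain ⟨ev, h1, h2, h3, -⟩ := hl.exists_fair_run S.drivenInit Set.univ_nonempty
    (fun _ => (𝓓).Valid S.drivenInit) σ hσ (fun _ _ h => h)
    (fun _ τ hτ p _ κ ha => ⟨[⟨p, κ, true⟩], true, by simp, by
      rw [valid_append]; exact ⟨hτ, ha, trivial⟩⟩)
  exact ⟨ev, h1, h2, h3⟩

/-- Without Byzantine processes, a block that is read has been appended by a correct process. -/
theorem exists_append_of_read [Countable Proc] [Nonempty Proc] (hsol : S.SolvesUBDEP P len f)
    (hS : S.Regular) (hβ : Supply g β) (hl : (𝓓).Live) {σ : List (Move Proc (Option S.Kind))}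
    (hσ : (𝓓).Valid S.drivenInit σ) {o : Proc × Blockchain B g}
    (ho : o ∈ (𝓓).outs S.drivenInit σ) {b : B} (hb : b ∈ o.2.blocks) (hbg : b ≠ g) :
    ∃ (t : ℕ) (ht : t < σ.length), ∃ n ≤ t, b = β σ[t].proc n σ[t].choice := by
  classical
  obtain ⟨ev, hr, hf, hev⟩ := exists_fair_extension hl hσ
  have hf' : (𝓓).Fair S.drivenInit {p | p ∉ (∅ : Finset Proc)} ev := fun p _ => hf p trivial
  obtain ⟨-, H, hH, ⟨-, hint, -⟩, -⟩ := hsol ∅ (by simp) (toExecution hS hβ ev hr hf')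
  rw [← hev] at ho
  obtain ⟨t, ht, ho⟩ := mem_outs_initial.1 ho
  obtain ⟨⟨t', p, l⟩, ⟨haH, hal⟩, hat⟩ := hint _ _
    ((isRead_iff hH).2 ⟨t, o.1, Finset.notMem_empty _, rfl, ho⟩) b hb hbg
  obtain rfl : l = .inv (.append b) := hal
  obtain ⟨h1, -, h2⟩ := (produces_inv (Finset.notMem_empty p)).1
    ((hH.1 _ (Finset.notMem_empty p)).1 haH)
  have ht' : t' < t := hat
  have hlt : t' < σ.length := ht'.trans ht
  have hget : σ[t'] = ev t' := by
    have : σ[t'] = (initial ev σ.length)[t']'(by simpa using hlt) := by congr 1; exact hev.symm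
    rw [this]
    simp [initial]
  refine ⟨t', hlt, _, calls_le hr p t', ?_⟩
  rw [hget, h1]
  exact (nextCall_eq_append.1 h2.symm).2.symm

/-- If one process stops, the others still read chains of unbounded length, because it might be
Byzantine. -/
theorem driven_grows [Countable Proc] [Nontrivial Proc] (hsol : S.SolvesUBDEP P len f)
    (hf1 : 1 ≤ f) (hS : S.Regular) (hβ : Supply g β) (hl : (𝓓).Live) :
    (𝓓).Grows len S.drivenInit := by
  classical
  intro σ hσ p c k
  obtain ⟨q, hq⟩ := exists_ne p
  have hq' : q ∉ ({p} : Finset Proc) := by simpa using hq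
  obtain ⟨ev, hr, hf, -, hI⟩ := hl.exists_fair_run S.drivenInit
    (Q := {r | r ∉ ({p} : Finset Proc)}) ⟨q, hq'⟩
    (fun _ ρ => ∃ τ, ρ = σ ++ τ ∧ (𝓓).Valid ((𝓓).run S.drivenInit σ) τ ∧
      ∀ e ∈ τ, e.proc ≠ p ∧ e.choice = c) σ ⟨[], by simp, trivial, by simp⟩
    (by rintro _ _ ⟨τ, rfl, h, -⟩; rw [valid_append]; exact ⟨hσ, h⟩)
    (by
      rintro _ _ ⟨τ, rfl, h1, h2⟩ r hrp κ hap
      rw [run_append] at hap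
      refine ⟨[⟨r, κ, c⟩], c, by simp, τ ++ [⟨r, κ, c⟩], by simp, ?_, ?_⟩
      · rw [valid_append]; exact ⟨h1, hap, trivial⟩
      · intro e he
        rcases List.mem_append.1 he with he | he
        · exact h2 e he
        · obtain rfl := List.mem_singleton.1 he
          exact ⟨by simpa using hrp, rfl⟩)
  -- too long to be a chain read in `σ`
  obtain ⟨t, x, hx, hk⟩ := exists_long_read hsol hS hβ (by simpa using hf1) hr hf hq'
    (k + (((𝓓).outs S.drivenInit σ).map fun o => len o.2).sum)
  obtain ⟨t', ht', -, τ, hτ, h1, h2⟩ := hI (t + 1)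
  have hmem : x ∈ (𝓓).outs S.drivenInit (initial ev t') := mem_outs_initial.2 ⟨t, ht', hx⟩
  rw [hτ, outs_append, List.mem_append] at hmem
  rcases hmem with hmem | hmem
  · have := List.le_sum_of_mem (List.mem_map_of_mem (f := fun o => len o.2) hmem)
    omega
  · exact ⟨τ, h1, h2, x, hmem, by omega⟩

theorem driven_rereads [Countable Proc] [Nonempty Proc] (hsol : S.SolvesUBDEP P len f)
    (hS : S.Regular) (hβ : Supply g β) (hl : (𝓓).Live) : (𝓓).Rereads S.drivenInit := by
  classical
  intro σ hσ
  obtain ⟨ev, hr, hf, hev⟩ := exists_fair_extension hl hσ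
  have hf' : (𝓓).Fair S.drivenInit {p | p ∉ (∅ : Finset Proc)} ev := fun p _ => hf p trivial
  obtain ⟨hT, -⟩ := hsol ∅ (by simp) (toExecution hS hβ ev hr hf')
  obtain ⟨q⟩ := ‹Nonempty Proc›
  have hlate : ∀ n, ∃ t, n ≤ t ∧ ∃ bc,
      (𝓓).output ((𝓓).conf S.drivenInit ev t) (ev t) = some (q, bc) := by
    intro n
    obtain ⟨t, bc, h1, h2⟩ := exists_read hT (Finset.notMem_empty q) n
    have := calls_le hr q t
    exact ⟨t, by omega, bc, h1⟩
  obtain ⟨t₁, ht₁, b₁, h₁⟩ := hlate σ.length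
  obtain ⟨t₂, ht₂, b₂, h₂⟩ := hlate (t₁ + 1)
  obtain ⟨τ, hτ⟩ := initial_prefix ev ht₁
  obtain ⟨ρ, hρ⟩ := initial_prefix ev ht₂
  rw [hev] at hτ
  have hc₁ : (𝓓).conf S.drivenInit ev t₁ = (𝓓).run ((𝓓).run S.drivenInit σ) τ := by
    rw [conf, ← hτ, run_append]
  have hc₂ : (𝓓).conf S.drivenInit ev t₂ =
      (𝓓).run ((𝓓).apply ((𝓓).run ((𝓓).run S.drivenInit σ) τ) (ev t₁)) ρ := by
    rw [conf, ← hρ, run_append, ← hc₁, ← conf_succ]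
    rfl
  rw [hc₁] at h₁
  rw [hc₂] at h₂
  refine ⟨τ ++ [ev t₁] ++ ρ ++ [ev t₂], ?_, (q, b₁), (q, b₂), ?_, rfl⟩
  · have hv := hr.valid_initial (t₂ + 1)
    rw [initial_succ, ← hρ, initial_succ, ← hτ] at hv
    simp only [List.append_assoc, valid_append] at hv
    simp only [List.append_assoc, valid_append]
    exact hv.2
  · simp only [outs_append, outs_cons, outs_nil, run_cons, run_nil, h₁, h₂,
      Option.toList_some, List.append_assoc, List.append_nil]
    exact List.sublist_append_of_sublist_right
      ((List.Sublist.refl [(q, b₁)]).append (List.sublist_append_right _ [(q, b₂)]))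

/-- A medium in which the moves of a process can be hidden from the others does not allow a
solution. -/
theorem not_solvesUBDEP [Countable Proc] [Nontrivial Proc] [Infinite B] (W : Prop)
    (hS : S.Regular) (hW : W ∨ Subsingleton S.Kind) {sim : Proc → S.Med → S.Med → Prop}
    (hh : ∀ β, (S.driven W β).Hides sim) (hf : 1 ≤ f) : ¬ S.SolvesUBDEP P len f := by
  classical
  intro hsol
  have : Infinite {b : B // b ≠ g} := (Set.finite_singleton g).infinite_compl.to_subtype
  obtain ⟨enc, henc⟩ := exists_injective_nat (Proc × ℕ × Bool)
  let bl := Infinite.natEmbedding {b : B // b ≠ g}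
  let β : Proc → ℕ → Bool → B := fun p n c => bl (enc (p, n, c))
  have hβ : Supply g β :=
    { ne := fun p n c => (bl (enc (p, n, c))).2
      inj := fun h => by simpa using henc (bl.injective (Subtype.ext h)) }
  have hl : (S.driven W β).Live := driven_live hS hW
  refine false_of_growth_of_stable (s₀ := S.drivenInit) hl (hh β) (driven_rereads hsol hS hβ hl)
    (driven_grows hsol hf hS hβ hl) (fun c => {b | ∃ p n, b = β p n c}) ?_ ?_ ?_
  · rw [Set.disjoint_left]
    rintro b ⟨p, n, rfl⟩ ⟨p', n', h⟩
    exact absurd (hβ.inj h).2.2 (by simp)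
  · intro σ hσ
    refine ⟨insert g (((List.product σ (List.range σ.length)).map
      fun x => β x.1.proc x.2 x.1.choice).toFinset), ?_⟩
    intro c τ hτ hc o ho b hb
    by_cases hbg : b = g
    · exact Or.inl (by simp [hbg])
    obtain ⟨t, ht, n, hn, rfl⟩ := exists_append_of_read hsol hS hβ hl (σ := σ ++ τ)
      (by rw [valid_append]; exact ⟨hσ, hτ⟩) (by rw [outs_append]; simp [ho]) hb hbg
    by_cases hts : t < σ.length
    · left
      rw [List.getElem_append_left hts, Finset.mem_insert, List.mem_toFinset, List.mem_map]
      exact Or.inr ⟨(σ[t], n), List.mem_product.2 ⟨List.getElem_mem hts, by simp; omega⟩, rfl⟩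
    · right
      rw [List.getElem_append_right (by omega)]
      exact ⟨_, n, by rw [hc _ (List.getElem_mem _)]⟩
  · intro ev hr hfe
    obtain ⟨q⟩ : Nonempty Proc := inferInstance
    exact ⟨exists_long_read (F := ∅) hsol hS hβ (by simp) hr (fun p _ => hfe p trivial)
      (Finset.notMem_empty q), exists_stable hsol hS hβ hr hfe⟩

end Solves

end AsyncSystem

/-! ### Message passing and shared memory -/

namespace MessagePassingProtocol

open Machine AsyncSystem

variable {Proc : Type uP} {B : Type uB} {g : B} {Msg : Type u}

/-- All messages to processes other than `p` that are in transit in `net` are in transit in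
`net'`. -/
def MoreMessages (p : Proc) (net net' : Proc → Proc → Multiset Msg) : Prop :=
  ∀ q r, r ≠ p → net q r ≤ net' q r

theorem le_send (p : Proc) (out : Proc → Multiset Msg) (net : Proc → Proc → Multiset Msg)
    (q r : Proc) : net q r ≤ send p out net q r := by
  unfold send
  split_ifs
  · exact Multiset.le_add_right _ _
  · exact le_rfl

theorem send_of_ne {p q : Proc} (h : q ≠ p) (out : Proc → Multiset Msg)
    (net : Proc → Proc → Multiset Msg) (r : Proc) : send p out net q r = net q r :=
  if_neg h

theorem receive_of_ne {p r : Proc} (h : r ≠ p) (x : Option (Proc × Msg))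
    (net : Proc → Proc → Multiset Msg) (q : Proc) : receive p x net q r = net q r := by
  cases x with
  | none => rfl
  | some x => exact if_neg fun hh => h hh.2

theorem receive_le (p : Proc) (x : Option (Proc × Msg)) (net : Proc → Proc → Multiset Msg)
    (q r : Proc) : receive p x net q r ≤ net q r := by
  classical
  cases x with
  | none => exact le_rfl
  | some x =>
    simp only [receive]
    split_ifs
    · convert Multiset.erase_le _ _
    · exact le_rfl

theorem receive_mono {p q r : Proc} (x : Option (Proc × Msg))
    {net net' : Proc → Proc → Multiset Msg} (h : net q r ≤ net' q r) :
    receive p x net q r ≤ receive p x net' q r := by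
  classical
  cases x with
  | none => exact h
  | some x =>
    simp only [receive]
    split_ifs
    · exact Multiset.erase_le_erase _ h
    · exact h

theorem send_mono {p q r : Proc} (out : Proc → Multiset Msg)
    {net net' : Proc → Proc → Multiset Msg} (h : net q r ≤ net' q r) :
    send p out net q r ≤ send p out net' q r := by
  unfold send
  split_ifs
  · gcongr
  · exact h

variable (π : MessagePassingProtocol.{uP, uB, u} Proc B g)

theorem toSystem_regular [Countable Proc] : π.toSystem.Regular where
  byz_refl p m := ⟨fun _ _ => le_rfl, fun _ _ => le_rfl, fun _ _ _ _ => rfl⟩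
  byz_step p x l net _ := by
    refine ⟨fun r hr => ?_, fun q hq => ?_, fun q r hq hr => ?_⟩
    · rw [← receive_of_ne hr x net p]
      exact le_send _ _ _ _ _
    · exact (send_of_ne hq _ _ _).le.trans (receive_le _ _ _ _ _)
    · exact (send_of_ne hq _ _ _).trans (receive_of_ne hr _ _ _)
  persists p x p' x' l net h _ hne := by
    classical
    rintro q m rfl
    refine Multiset.mem_of_le (le_send _ _ _ _ _) ?_
    have hm : m ∈ net q p := h q m rfl
    cases x' with
    | none => exact hm
    | some x' =>
      simp only [receive]
      split_ifs with hc
      · obtain ⟨rfl, rfl⟩ := hc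
        refine (Multiset.mem_erase_of_ne ?_).2 hm
        rintro rfl
        exact hne ⟨rfl, rfl⟩
      · exact hm
  countable p net := by
    have hc : (⋃ q : Proc, (fun m => some (q, m)) '' {m | m ∈ net q p}).Countable :=
      Set.countable_iUnion fun q =>
        ((Multiset.finite_toSet (net q p)).image _).countable
    refine (hc.insert none).mono ?_
    rintro (_ | ⟨q, m⟩) hx
    · exact Set.mem_insert _ _
    · exact Set.mem_insert_of_mem _ (Set.mem_iUnion.2 ⟨q, m, hx q m rfl, rfl⟩)
  exists_enabled p net := ⟨none, fun _ _ h => absurd h (by simp)⟩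

/-- A process that moves only adds messages to the channels of the others. -/
theorem driven_hides (β : Proc → ℕ → Bool → B) :
    (π.toSystem.driven True β).Hides MoreMessages where
  refl p net q r _ := le_rfl
  next p q κ c l net net' hq hs happ := by
    cases κ with
    | none => exact ⟨happ, rfl, rfl, hs⟩
    | some x =>
      refine ⟨⟨?_, Or.inl trivial⟩, rfl, rfl, ?_⟩
      · rintro r m rfl
        exact Multiset.mem_of_le (hs r q hq) (happ.1 r m rfl)
      · exact fun r r' hr' => send_mono _ (receive_mono _ (hs r r' hr'))
  choice p κ c c' l net q r _ := by
    cases κ <;> exact le_rfl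
  interplay := by
    refine Or.inl fun p κ c l net _ q r hr => ?_
    cases κ with
    | none => exact le_rfl
    | some x => exact (receive_of_ne hr x net q).ge.trans (le_send _ _ _ _ _)

end MessagePassingProtocol

namespace SharedMemoryProtocol

open Machine AsyncSystem

variable {Proc : Type uP} {B : Type uB} {g : B} (π : SharedMemoryProtocol.{uP, uB, u} Proc B g)

theorem toSystem_regular : π.toSystem.Regular where
  byz_refl p m := Or.inl rfl
  byz_step p a l mem _ := by
    simp only [toSystem]
    split
    · exact Or.inl rfl
    · exact Or.inr ⟨_, _, rfl⟩
    · exact Or.inl rfl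
  persists p a p' a' l mem h _ _ := trivial
  countable p mem := Set.to_countable (α := Unit) _
  exists_enabled p mem := ⟨(), trivial⟩

/-- A move of a process reads the memory without changing it, or changes it without reading it: the
new memory is `mem`, or the new local state is `l'` whatever the memory is and `y` is
written to the register `x`. -/
theorem next_cases (β : Proc → ℕ → Bool → B) (p : Proc) (κ : Option Unit) (c : Bool)
    (l : π.toSystem.LocalState) :
    (∀ mem, ((π.toSystem.driven False β).next p κ c l mem).2 = mem) ∨
    ∃ l' x y, ∀ mem, (π.toSystem.driven False β).next p κ c l mem = (l', π.write p x y mem) := by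
  cases κ with
  | none => exact Or.inl fun _ => rfl
  | some a =>
    cases h : π.program p l.loc with
    | read x next =>
      refine Or.inl fun mem => ?_
      simp only [driven, toSystem, h]
      rfl
    | write x y next =>
      refine Or.inr ⟨⟨next.1, pendAfter next.2 l.pend, l.calls⟩, x, y, fun mem => ?_⟩
      simp only [driven, toSystem, h]
    | skip next =>
      refine Or.inl fun mem => ?_
      simp only [driven, toSystem, h]
      rfl

theorem write_write_or_comm (p q : Proc) (x x' : π.Reg) (y y' : π.Val) (mem : π.Reg → π.Val) :
    π.write p x y (π.write q x' y' mem) = π.write p x y mem ∨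
    π.write p x y (π.write q x' y' mem) = π.write q x' y' (π.write p x y mem) := by
  by_cases h : x = x' ∧ π.mayWrite p x
  · left
    funext z
    simp only [write]
    grind
  · right
    funext z
    simp only [write]
    grind

theorem driven_hides (β : Proc → ℕ → Bool → B) :
    (π.toSystem.driven False β).Hides (fun _ mem mem' => mem = mem') where
  refl p mem := rfl
  next p q κ c l mem mem' _ h happ := by
    subst h
    exact ⟨happ, rfl, rfl, rfl⟩
  choice p κ c c' l mem := by
    cases κ <;> rfl
  interplay := by
    refine Or.inr ⟨?_, ?_⟩
    · rintro p (_ | _) (_ | _) l mem h h'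
      · rfl
      · exact absurd h (h'.2.resolve_left not_false)
      · exact absurd h' (h.2.resolve_left not_false)
      · rfl
    · rintro s e e' - - hne
      rcases next_cases π β e.proc e.kind e.choice (s.loc e.proc) with he | ⟨l, x, y, he⟩
      · refine Or.inr (sim_comm hne ?_ ?_)
        · rw [he]
        · rw [he, he]
      rcases next_cases π β e'.proc e'.kind e'.choice (s.loc e'.proc) with he' | ⟨l', x', y', he'⟩
      · refine Or.inl (sim_hidden hne ?_)
        rw [he']
      rcases write_write_or_comm π e.proc e'.proc x x' y y' s.med with hw | hw
      · refine Or.inl (sim_hidden hne ?_)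
        rw [he', he, he]
        exact congrArg (Prod.mk l) hw
      · refine Or.inr (sim_comm hne ?_ ?_)
        · rw [he', he']
        · rw [he', he, he, he']
          exact hw

end SharedMemoryProtocol

theorem mainTheorem4 {Proc : Type uP} {B : Type uB} [Countable Proc] [Nontrivial Proc] [Infinite B]
    (g : B) (P : Blockchain B g → Prop) (len : Blockchain B g → ℕ)
    (hlen : ∀ (bc bc' : Blockchain B g) (b : B), bc'.blocks = bc.blocks ++ [b] → len bc < len bc')
    (f : ℕ) (hf : 1 ≤ f) :
    (¬ ∃ π : MessagePassingProtocol.{uP, uB, u} Proc B g, π.toSystem.SolvesUBDEP P len f) ∧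
    (¬ ∃ π : SharedMemoryProtocol.{uP, uB, u} Proc B g, π.toSystem.SolvesUBDEP P len f) := by
  refine ⟨?_, ?_⟩
  · rintro ⟨π, hπ⟩
    exact AsyncSystem.not_solvesUBDEP True π.toSystem_regular (Or.inl trivial) π.driven_hides hf hπ
  · rintro ⟨π, hπ⟩
    exact AsyncSystem.not_solvesUBDEP False π.toSystem_regular
      (Or.inr (inferInstanceAs (Subsingleton Unit))) π.driven_hides hf hπ
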